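/- **Restricted Cramér–Wold Theorem.** For a Borel set $\Gamma\subset\mathbb R^2$, let $\mathcal{AC}(\Gamma)$ be the set of finite complex Borel measures on $\mathbb R^2$ that are supported in $\Gamma$ and absolutely continuous with respect to arc length on $\Gamma$. For $\theta\in\mathbb R$ let $\ell_\theta=\{(t\cos\theta,t\sin\theta):t\in\mathbb R\}$ and $\pi_\theta(x)=x_1\cos\theta+x_2\sin\theta$. For a finite complex Borel measure $\mu$ on $\mathbb R^2$ put $\widehat\mu(\xi)=\int_{\mathbb R^2}e^{-i\langle\xi,x\rangle}\,d\mu(x)$, and let $R[\mu](\theta,\cdot)$ be its Radon projection in direction $\theta$, i.e. the push-forward measure $R[\mu](\theta,B)=\mu(\pi_\theta^{-1}(B))$ for Borel $B\subset\mathbb R$. For $\Lambda\subset\mathbb R^2$, the pair $(\Gamma,\Lambda)$ is a *Heisenberg Uniqueness Pair* if the only $\mu\in\mathcal{AC}(\Gamma)$ with $\widehat\mu=0$ on $\Lambda$ is $\mu=0$. Let $\Gamma$ be one of the following curves: (i) the graph $\{(t,|t|^\alpha):t\in\mathbb R\}$ for some real $\alpha>0$; (ii) a hyperbola; (iii) a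 convex polygon (the boundary of the convex hull of finitely many points that do not all lie on a line); (iv) an ellipse. Then there exists a measurable set $E\subset(-\pi/2,\pi/2)\times(-\pi/2,\pi/2)$ of positive Lebesgue measure such that $(\Gamma,\ell_{\theta_1}\cup\ell_{\theta_2})$ is a Heisenberg Uniqueness Pair for every $(\theta_1,\theta_2)\in E$. Moreover, for every such set $E$ and every $(\theta_1,\theta_2)\in E$: if $\mu\in\mathcal{AC}(\Gamma)$ satisfies $R[\mu](\theta_1,\cdot)=R[\mu](\theta_2,\cdot)=0$, then $\mu=0$. -/

import Mathlib

open MeasureTheory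

noncomputable section

/-- The Euclidean plane `ℝ²`. -/
abbrev Plane : Type := EuclideanSpace ℝ (Fin 2)

/-- The unit vector `(cos θ, sin θ)`. -/
def dirVec (θ : ℝ) : Plane := !₂[Real.cos θ, Real.sin θ]

/-- The line through the origin spanned by `(cos θ, sin θ)`. -/
def lineThrough (θ : ℝ) : Set Plane := {x | ∃ t : ℝ, x = t • dirVec θ}

/-- Arc length on a curve `Γ`, as a Borel measure on the plane: the one-dimensional Hausdorff
measure restricted to `Γ`. -/
def arcLength (Γ : Set Plane) : Measure Plane := (Measure.hausdorffMeasure 1).restrict Γ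

/-- The finite complex Borel measures on the plane that are supported in `Γ`. -/
def measuresOn (Γ : Set Plane) : Set (ComplexMeasure Plane) :=
  {μ | ∀ A : Set Plane, MeasurableSet A → Disjoint A Γ → μ A = 0}

/-- The finite complex Borel measures supported in `Γ` that are absolutely continuous with
respect to arc length on `Γ`. -/
def acMeasures (Γ : Set Plane) : Set (ComplexMeasure Plane) :=
  {μ | μ ∈ measuresOn Γ ∧ ∀ A : Set Plane, MeasurableSet A → arcLength Γ A = 0 → μ A = 0}

/-- The Fourier transform `ξ ↦ ∫ exp (-i ⟨ξ, x⟩) dμ(x)` of a complex measure on the plane. -/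
def fourierTransform (μ : ComplexMeasure Plane) (ξ : Plane) : ℂ :=
  VectorMeasure.integral μ (fun x : Plane => Complex.exp (-Complex.I * ((inner ℝ ξ x : ℝ) : ℂ)))
    (ContinuousLinearMap.mul ℝ ℂ)

/-- `(Γ, Λ)` is a Heisenberg Uniqueness Pair. -/
def IsHeisenbergUniquenessPair (Γ Λ : Set Plane) : Prop :=
  ∀ μ ∈ acMeasures Γ, (∀ ξ ∈ Λ, fourierTransform μ ξ = 0) → μ = 0

/-- The projection `x ↦ ⟨x, (cos θ, sin θ)⟩`. -/
def dirProj (θ : ℝ) (x : Plane) : ℝ := inner ℝ x (dirVec θ)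

/-- The Radon projection `R[μ](θ, ·)`: the push-forward of `μ` under the projection in
direction `θ`. -/
def radon (μ : ComplexMeasure Plane) (θ : ℝ) : ComplexMeasure ℝ := μ.map (dirProj θ)

theorem measurable_dirProj (θ : ℝ) : Measurable (dirProj θ) := by
  unfold dirProj
  fun_prop

/-- `R[μ](θ, B) = μ (π_θ ⁻¹ B)`; in particular the default value of `VectorMeasure.map` for
non-measurable maps plays no role. -/
theorem radon_apply (μ : ComplexMeasure Plane) (θ : ℝ) {B : Set ℝ} (hB : MeasurableSet B) :
    radon μ θ B = μ (dirProj θ ⁻¹' B) :=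
  VectorMeasure.map_apply μ (measurable_dirProj θ) hB

/-- The graph of `t ↦ |t| ^ α`. -/
def powerGraph (α : ℝ) : Set Plane := {x | x 1 = |x 0| ^ α}

/-- A hyperbola (both branches): an affine image of `v² - u² = 1`. -/
def IsHyperbola (Γ : Set Plane) : Prop :=
  ∃ T : Plane ≃ᵃ[ℝ] Plane, Γ = T '' {x : Plane | x 1 ^ 2 - x 0 ^ 2 = 1}

/-- An ellipse: an affine image of the unit circle. -/
def IsEllipse (Γ : Set Plane) : Prop :=
  ∃ T : Plane ≃ᵃ[ℝ] Plane, Γ = T '' {x : Plane | x 0 ^ 2 + x 1 ^ 2 = 1}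

/-- A (closed, non-degenerate) convex polygon: the boundary of the convex hull of a finite set
of points that do not all lie on one line. -/
def IsConvexPolygon (Γ : Set Plane) : Prop :=
  ∃ V : Finset Plane, (interior (convexHull ℝ (V : Set Plane))).Nonempty ∧
    Γ = frontier (convexHull ℝ (V : Set Plane))

/-- The curves under consideration. -/
def IsAdmissibleCurve (Γ : Set Plane) : Prop :=
  (∃ α : ℝ, 0 < α ∧ Γ = powerGraph α) ∨ IsHyperbola Γ ∨ IsConvexPolygon Γ ∨ IsEllipse Γ

/-- `E` is a set of positive measure of pairs of angles in `(-π/2, π/2)` such that `Γ` and the two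
lines with these angles form a Heisenberg Uniqueness Pair. -/
structure IsUniquenessAngleSet (Γ : Set Plane) (E : Set (ℝ × ℝ)) : Prop where
  subset : E ⊆ Set.Ioo (-(Real.pi / 2)) (Real.pi / 2) ×ˢ Set.Ioo (-(Real.pi / 2)) (Real.pi / 2)
  measurableSet : MeasurableSet E
  volume_pos : 0 < volume E
  isHUP : ∀ θ₁ θ₂ : ℝ, (θ₁, θ₂) ∈ E →
    IsHeisenbergUniquenessPair Γ (lineThrough θ₁ ∪ lineThrough θ₂)

end

open MeasureTheory

/-! The Fourier transform of `μ` restricted to a line through the origin is the one-dimensional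
transform of the Radon projection in that direction, so one vanishes exactly when the other does
(`fourierTransform_eq_zero_on_lineThrough_iff`). This gives the final claim and turns uniqueness
into a question about two projections. Passing to real and imaginary parts and their Jordan
decompositions, it remains to show that mutually singular positive measures `p`, `n` on `Γ` with
equal projections in both directions vanish; this is `DeterminedBy`.

For graphs, hyperbolas and polygons, `Γ` splits into two pieces, one on which a functional `F` is
injective and one on which `G` is. Where `F` is injective, the mass of `p` can only be balanced by
mass of `n` on the other piece at the same level of `F` (`measure_inter_preimage_le`). So each piece
is dominated by the other, once along levels of `F` and once along levels of `G`. If `G < F` on one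
piece and `F ≤ G` on the other, these dominations are incompatible with positive mass
(`determinedBy_of_injOn`). The conditions on the functionals hold on a nonempty open set of pairs,
hence for a nonempty open set of angles.

For ellipses, reduced to the circle by an affine map, each projection fixes one real linear
combination of the real and imaginary parts of every moment `∫ z ^ k`. Two projections fix all
moments unless a determinant vanishes for some `k ≥ 1`, which happens only for a null set of pairs
of angles. -/

/-- A mutually singular pair of finite measures carried by `Γ` with equal images under both `f`
and `g` is trivial. -/
def DeterminedBy {X : Type*} [MeasurableSpace X] (Γ : Set X) (f g : X → ℝ) : Prop :=
  ∀ p n : Measure X, IsFiniteMeasure p → IsFiniteMeasure n → p.MutuallySingular n →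
    p Γᶜ = 0 → n Γᶜ = 0 → p.map f = n.map f → p.map g = n.map g → p = n

/-! ### Mass balance between mutually singular measures with equal images. -/

section Measures

variable {X : Type*} [MeasurableSpace X]

theorem map_comp_eq_of_map_eq {Y Z : Type*} [MeasurableSpace Y] [MeasurableSpace Z]
    {p n : Measure X} {f : X → Y} {φ : Y → Z}
    (hf : Measurable f) (hφ : Measurable φ) (h : p.map f = n.map f) :
    p.map (fun x => φ (f x)) = n.map (fun x => φ (f x)) := by
  have := congrArg (Measure.map φ) h
  rwa [Measure.map_map hφ hf, Measure.map_map hφ hf] at this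

theorem DeterminedBy.swap {Γ : Set X} {f g : X → ℝ} (h : DeterminedBy Γ f g) :
    DeterminedBy Γ g f :=
  fun p n hp hn hs hpΓ hnΓ hf hg => h p n hp hn hs hpΓ hnΓ hg hf

/-- Lets functionals be shifted and rescaled to a convenient normal form. -/
theorem DeterminedBy.of_comp {Γ : Set X} {f g : X → ℝ} {φ ψ : ℝ → ℝ}
    (h : DeterminedBy Γ (fun x => φ (f x)) (fun x => ψ (g x)))
    (hf : Measurable f) (hg : Measurable g) (hφ : Measurable φ) (hψ : Measurable ψ) :
    DeterminedBy Γ f g :=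
  fun p n hp hn hs hpΓ hnΓ hpf hpg => h p n hp hn hs hpΓ hnΓ
    (map_comp_eq_of_map_eq hf hφ hpf) (map_comp_eq_of_map_eq hg hψ hpg)

variable [StandardBorelSpace X]

/-- If `f` is injective on the set `B`, then the mass that `p` puts on `B` has to be cancelled by
mass that `n` puts on the complement of `B`. -/
theorem measure_inter_preimage_le {Y : Type*} [MeasurableSpace Y] [StandardBorelSpace Y]
    {p n : Measure X} (hs : p.MutuallySingular n)
    {f : X → Y} (hf : Measurable f) (hmap : p.map f = n.map f) {B : Set X} (hB : MeasurableSet B)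
    (hinj : Set.InjOn f B) {S : Set Y} (hS : MeasurableSet S) :
    p (B ∩ f ⁻¹' S) ≤ n (Bᶜ ∩ f ⁻¹' S) := by
  obtain ⟨P, hP, hpP, hnP⟩ := hs
  -- `p` is carried by `Pᶜ`, `n` by `P`
  have hBP : MeasurableSet (f '' (B ∩ Pᶜ)) :=
    (hB.inter hP.compl).image_of_measurable_injOn hf (hinj.mono Set.inter_subset_left)
  have h1 : p (B ∩ f ⁻¹' S) ≤ p (f ⁻¹' (S ∩ f '' (B ∩ Pᶜ))) := by
    calc p (B ∩ f ⁻¹' S) ≤ p ((B ∩ f ⁻¹' S) ∩ Pᶜ ∪ P) :=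
          measure_mono fun x hx => by by_cases h : x ∈ P <;> simp_all
      _ ≤ p ((B ∩ f ⁻¹' S) ∩ Pᶜ) + p P := measure_union_le _ _
      _ = p ((B ∩ f ⁻¹' S) ∩ Pᶜ) := by rw [hpP, add_zero]
      _ ≤ p (f ⁻¹' (S ∩ f '' (B ∩ Pᶜ))) :=
          measure_mono fun x hx => ⟨hx.1.2, x, ⟨hx.1.1, hx.2⟩, rfl⟩
  have h2 : p (f ⁻¹' (S ∩ f '' (B ∩ Pᶜ))) = n (f ⁻¹' (S ∩ f '' (B ∩ Pᶜ))) := by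
    rw [← Measure.map_apply hf (hS.inter hBP), hmap, Measure.map_apply hf (hS.inter hBP)]
  -- A point on the same fibre as a point of `B ∩ Pᶜ` is either outside `B` or, by injectivity, that
  -- very point, and `n` does not charge `Pᶜ`.
  have h3 : n (f ⁻¹' (S ∩ f '' (B ∩ Pᶜ))) ≤ n ((Bᶜ ∩ f ⁻¹' S) ∪ Pᶜ) := by
    refine measure_mono ?_
    rintro x ⟨hxS, y, ⟨hyB, hyP⟩, hyx⟩
    by_cases hx : x ∈ B
    · have := hinj hyB hx hyx
      subst this
      exact Or.inr hyP
    · exact Or.inl ⟨hx, hxS⟩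
  refine h1.trans (h2.le.trans (h3.trans ((measure_union_le _ _).trans ?_)))
  rw [hnP, add_zero]

/-- The sum of the estimate and its mirror image: with a single measure on both sides, estimates for
different functionals can be chained. -/
theorem add_measure_inter_preimage_le {Y : Type*} [MeasurableSpace Y] [StandardBorelSpace Y]
    {p n : Measure X} (hs : p.MutuallySingular n)
    {f : X → Y} (hf : Measurable f) (hmap : p.map f = n.map f) {B : Set X} (hB : MeasurableSet B)
    (hinj : Set.InjOn f B) {S : Set Y} (hS : MeasurableSet S) :
    (p + n) (B ∩ f ⁻¹' S) ≤ (p + n) (Bᶜ ∩ f ⁻¹' S) := by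
  rw [Measure.add_apply, Measure.add_apply, add_comm (p (Bᶜ ∩ _))]
  exact add_le_add (measure_inter_preimage_le hs hf hmap hB hinj hS)
    (measure_inter_preimage_le hs.symm hf hmap.symm hB hinj hS)

theorem eq_of_map_eq_of_injOn {Y : Type*} [MeasurableSpace Y] [StandardBorelSpace Y]
    {p n : Measure X} (hs : p.MutuallySingular n) {Γ : Set X} (hΓ : MeasurableSet Γ)
    (hp : p Γᶜ = 0) (hn : n Γᶜ = 0) {f : X → Y} (hf : Measurable f) (hmap : p.map f = n.map f)
    (hinj : Set.InjOn f Γ) : p = n := by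
  have h := add_measure_inter_preimage_le hs hf hmap hΓ hinj MeasurableSet.univ
  simp only [Set.preimage_univ, Set.inter_univ, Measure.add_apply, hp, hn, add_zero,
    nonpos_iff_eq_zero, add_eq_zero] at h
  have key : ∀ m : Measure X, m Γ = 0 → m Γᶜ = 0 → m = 0 := fun m h1 h2 => by
    rw [← Measure.measure_univ_eq_zero, ← Set.union_compl_self Γ]
    exact measure_union_null h1 h2
  rw [key p h.1 hp, key n h.2 hn]

/-- If `F` separates the points of the part of `Γ` in `C`, `G` separates those outside `C`, and
`G < F` on the former and `F ≤ G` on the latter, then `Γ` is determined by `F` and `G`. -/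
theorem determinedBy_of_injOn {Γ : Set X} (hΓ : MeasurableSet Γ) {C : Set X} (hC : MeasurableSet C)
    {F G : X → ℝ} (hF : Measurable F) (hG : Measurable G)
    (hFinj : Set.InjOn F (Γ ∩ C)) (hGinj : Set.InjOn G (Γ ∩ Cᶜ))
    (hlt : ∀ x ∈ Γ, x ∈ C → G x < F x) (hle : ∀ x ∈ Γ, x ∉ C → F x ≤ G x) :
    DeterminedBy Γ F G := by
  intro p n hp hn hs hpΓ hnΓ hmF hmG
  set m := p + n with hm
  have hmΓ : m Γᶜ = 0 := by simp [hm, hpΓ, hnΓ]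
  -- Since `m` is carried by `Γ`, inclusions need only be checked on `Γ`.
  have mono : ∀ A B : Set X, A ∩ Γ ⊆ B → m A ≤ m B := fun A B h => by
    calc m A ≤ m (B ∪ Γᶜ) := measure_mono fun x hx => by
          by_cases hxΓ : x ∈ Γ
          · exact Or.inl (h ⟨hx, hxΓ⟩)
          · exact Or.inr hxΓ
      _ ≤ m B + m Γᶜ := measure_union_le _ _
      _ = m B := by rw [hmΓ, add_zero]
  have hF1 : ∀ S, MeasurableSet S → m (C ∩ F ⁻¹' S) ≤ m (Cᶜ ∩ F ⁻¹' S) := fun S hS =>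
    ((mono _ (Γ ∩ C ∩ F ⁻¹' S) fun x hx => ⟨⟨hx.2, hx.1.1⟩, hx.1.2⟩).trans
      (add_measure_inter_preimage_le hs hF hmF (hΓ.inter hC) hFinj hS)).trans
      (mono _ _ fun x hx => ⟨fun h => hx.1.1 ⟨hx.2, h⟩, hx.1.2⟩)
  have hG1 : ∀ S, MeasurableSet S → m (Cᶜ ∩ G ⁻¹' S) ≤ m (C ∩ G ⁻¹' S) := fun S hS =>
    ((mono _ (Γ ∩ Cᶜ ∩ G ⁻¹' S) fun x hx => ⟨⟨hx.2, hx.1.1⟩, hx.1.2⟩).trans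
      (add_measure_inter_preimage_le hs hG hmG (hΓ.inter hC.compl) hGinj hS)).trans
      (mono _ _ fun x hx => ⟨by_contra fun h => hx.1.1 ⟨hx.2, h⟩, hx.1.2⟩)
  have hnull : ∀ r : ℝ, m (Γ ∩ C ∩ {x | G x ≤ r ∧ r < F x}) = 0 := by
    intro r
    have hr : MeasurableSet (Set.Ioi r) := measurableSet_Ioi
    -- The chain is `m (C, F > r) ≤ m (Cᶜ, F > r) ≤ m (Cᶜ, G > r) ≤ m (C, G > r)`. On `C` the last
    -- set lies inside the first because `G < F`, so their difference `G ≤ r < F` is null.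
    have h1 : m (C ∩ F ⁻¹' Set.Ioi r) ≤ m (C ∩ G ⁻¹' Set.Ioi r) :=
      (hF1 _ hr).trans ((mono _ (Cᶜ ∩ G ⁻¹' Set.Ioi r) fun x hx =>
        ⟨hx.1.1, lt_of_lt_of_le hx.1.2 (hle x hx.2 hx.1.1)⟩).trans (hG1 _ hr))
    have hdisj : Disjoint (C ∩ G ⁻¹' Set.Ioi r) (Γ ∩ C ∩ {x | G x ≤ r ∧ r < F x}) :=
      Set.disjoint_left.2 fun x hx hx' => absurd hx.2 (not_lt.2 hx'.2.1)
    have h2 : m (C ∩ G ⁻¹' Set.Ioi r) + m (Γ ∩ C ∩ {x | G x ≤ r ∧ r < F x}) ≤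
        m (C ∩ F ⁻¹' Set.Ioi r) := by
      rw [← measure_union' hdisj (hC.inter (hG hr))]
      refine mono _ _ ?_
      rintro x ⟨hx | hx, hxΓ⟩
      · exact ⟨hx.1, lt_trans hx.2 (hlt x hxΓ hx.1)⟩
      · exact ⟨hx.1.2, hx.2.2⟩
    have h3 := h2.trans h1
    by_contra h0
    exact absurd h3 (not_le.2 (ENNReal.lt_add_right (measure_ne_top _ _) h0))
  have hCnull : m C = 0 := by
    refine le_antisymm ((mono C (⋃ q : ℚ, Γ ∩ C ∩ {x | G x ≤ q ∧ (q : ℝ) < F x}) ?_).trans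
      (measure_iUnion_null fun q : ℚ => hnull q).le) bot_le
    rintro x ⟨hxC, hxΓ⟩
    obtain ⟨q, h1, h2⟩ := exists_rat_btwn (hlt x hxΓ hxC)
    exact Set.mem_iUnion.2 ⟨q, ⟨hxΓ, hxC⟩, h1.le, h2⟩
  have hCcnull : m Cᶜ = 0 := by
    have := hG1 _ MeasurableSet.univ
    simpa [hCnull] using this
  have hm0 : m Set.univ = 0 := by
    rw [← Set.union_compl_self C]; exact measure_union_null hCnull hCcnull
  rw [hm, Measure.add_apply, add_eq_zero] at hm0
  rw [Measure.measure_univ_eq_zero.1 hm0.1, Measure.measure_univ_eq_zero.1 hm0.2]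

end Measures

/-! ### Integration against complex measures and Fourier uniqueness on the line. -/

section ComplexMeasures

variable {X : Type*} [MeasurableSpace X]

/-- The complex measure `c • p`, for a finite measure `p`. -/
noncomputable def MeasureTheory.Measure.complexSMul (p : Measure X) [IsFiniteMeasure p] (c : ℂ) :
    ComplexMeasure X :=
  p.toSignedMeasure.mapRange
    (ContinuousLinearMap.toSpanSingleton ℝ c).toLinearMap.toAddMonoidHom
    (ContinuousLinearMap.toSpanSingleton ℝ c).continuous

theorem complexSMul_apply (p : Measure X) [IsFiniteMeasure p] (c : ℂ) {s : Set X}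
    (hs : MeasurableSet s) : p.complexSMul c s = (p.real s : ℂ) * c := by
  simp [Measure.complexSMul, VectorMeasure.mapRange_apply, hs]

theorem variation_complexSMul_le (p : Measure X) [IsFiniteMeasure p] (c : ℂ) :
    (p.complexSMul c).variation ≤ ‖c‖₊ • p := by
  refine VectorMeasure.variation_le_of_forall_enorm_le fun s hs => ?_
  have h : ‖((p.real s : ℝ) : ℂ)‖ₑ = p s := by
    rw [← ofReal_norm, Complex.norm_real, Real.norm_of_nonneg measureReal_nonneg]
    exact ENNReal.ofReal_toReal (measure_ne_top _ _)
  rw [complexSMul_apply p c hs, enorm_mul, mul_comm, h]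
  simp [enorm_eq_nnnorm]

instance (p : Measure X) [IsFiniteMeasure p] (c : ℂ) :
    IsFiniteMeasure (p.complexSMul c).variation :=
  isFiniteMeasure_of_le _ (variation_complexSMul_le p c)

theorem integral_complexSMul (p : Measure X) [IsFiniteMeasure p] (c : ℂ) {f : X → ℂ}
    (hf : Integrable f p) :
    VectorMeasure.integral (p.complexSMul c) f (ContinuousLinearMap.mul ℝ ℂ) =
      (∫ x, f x ∂p) * c := by
  set B := ContinuousLinearMap.mul ℝ ℂ
  have hT : DominatedFinMeasAdditive p ((p.complexSMul c).transpose B) (‖B‖ * ‖c‖) := by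
    refine ⟨fun s t hs ht _ _ hst => cbmApplyMeasure_union _ B hs ht hst, fun s hs _ => ?_⟩
    refine (norm_cbmApplyMeasure_le _ B s).trans ?_
    rw [complexSMul_apply p c hs, norm_mul, Complex.norm_real,
      Real.norm_of_nonneg measureReal_nonneg, mul_comm (p.real s), mul_assoc]
  -- The variation is at most `‖c‖ p`, so `p` can serve as reference measure; it then suffices to
  -- compare two continuous additive maps on indicators.
  rw [VectorMeasure.integral_eq_setToFun, ← setToFun_congr_measure_of_integrable (μ := p)
    (‖c‖₊ : ENNReal) ENNReal.coe_ne_top (variation_complexSMul_le p c) hT _ f hf]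
  refine hf.induction (P := fun f => setToFun p _ hT f = (∫ x, f x ∂p) * c) ?_ ?_ ?_ ?_
  · intro z s hs hsp
    rw [setToFun_indicator_const hT hs hsp.ne, integral_indicator_const z hs]
    change z * (p.complexSMul c) s = _
    rw [complexSMul_apply p c hs, Complex.real_smul]
    ring
  · intro f g _ hf hg h1 h2
    rw [setToFun_add hT hf hg, h1, h2, integral_add' hf hg, add_mul]
  · exact isClosed_eq (continuous_setToFun hT) (continuous_integral.mul continuous_const)
  · intro f g hfg _ h
    rw [← setToFun_congr_ae hT hfg, ← integral_congr_ae hfg, h]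

theorem complexMeasure_eq (ν : ComplexMeasure X) :
    ν = (ν.re.toJordanDecomposition.posPart.complexSMul 1 -
        ν.re.toJordanDecomposition.negPart.complexSMul 1) +
      (ν.im.toJordanDecomposition.posPart.complexSMul Complex.I -
        ν.im.toJordanDecomposition.negPart.complexSMul Complex.I) := by
  ext s hs
  have h1 := ν.re.apply_eq_posPart_real_sub_negPart_real hs
  have h2 := ν.im.apply_eq_posPart_real_sub_negPart_real hs
  have h3 : ν s = (ν.re s : ℂ) + (ν.im s : ℂ) * Complex.I := (Complex.re_add_im _).symm
  rw [h3, h1, h2]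
  simp [complexSMul_apply, hs]
  ring

instance (ν : ComplexMeasure X) : IsFiniteMeasure ν.variation := by
  rw [complexMeasure_eq ν]
  refine isFiniteMeasure_of_le _ (VectorMeasure.variation_add_le.trans
    (add_le_add VectorMeasure.variation_sub_le VectorMeasure.variation_sub_le))

/-- Reduces the vector-measure integral to ordinary integrals against the four Jordan parts, where
characteristic functions are available. -/
theorem integral_complexMeasure (ν : ComplexMeasure X) {f : X → ℂ} (hfm : Measurable f)
    {C : ℝ} (hfb : ∀ x, ‖f x‖ ≤ C) :
    VectorMeasure.integral ν f (ContinuousLinearMap.mul ℝ ℂ) =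
      (∫ x, f x ∂ν.re.toJordanDecomposition.posPart -
        ∫ x, f x ∂ν.re.toJordanDecomposition.negPart) +
      (∫ x, f x ∂ν.im.toJordanDecomposition.posPart -
        ∫ x, f x ∂ν.im.toJordanDecomposition.negPart) * Complex.I := by
  have hi : ∀ (m : Measure X) [IsFiniteMeasure m], Integrable f m := fun m _ =>
    Integrable.of_bound hfm.aestronglyMeasurable C (Filter.Eventually.of_forall hfb)
  conv_lhs => rw [complexMeasure_eq ν]
  rw [VectorMeasure.integral_add_vectorMeasure
      (VectorMeasure.Integrable.sub_vectorMeasure (hi _) (hi _))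
      (VectorMeasure.Integrable.sub_vectorMeasure (hi _) (hi _)),
    VectorMeasure.integral_sub_vectorMeasure (hi _) (hi _),
    VectorMeasure.integral_sub_vectorMeasure (hi _) (hi _)]
  simp only [integral_complexSMul _ _ (hi _)]
  ring

theorem signedMeasure_eq_zero_of_parts_eq {s : SignedMeasure X}
    (h : s.toJordanDecomposition.posPart = s.toJordanDecomposition.negPart) : s = 0 := by
  ext A hA
  rw [s.apply_eq_posPart_real_sub_negPart_real hA, h, sub_self]
  rfl

theorem complexMeasure_eq_zero {ν : ComplexMeasure X} (h1 : ν.re = 0) (h2 : ν.im = 0) :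
    ν = 0 := by
  ext A hA
  exact Complex.ext (congrArg (fun s : SignedMeasure X => s A) h1)
    (congrArg (fun s : SignedMeasure X => s A) h2)

theorem charFun_eq_conj_neg (m : Measure ℝ) (t : ℝ) :
    charFun m (-t) = (starRingEnd ℂ) (charFun m t) := charFun_neg t

/-- A complex measure on the line is determined by its Fourier transform. -/
theorem complexMeasure_eq_zero_of_integral_exp {ν : ComplexMeasure ℝ}
    (h : ∀ t : ℝ, VectorMeasure.integral ν
      (fun s : ℝ => Complex.exp (-Complex.I * ((t * s : ℝ) : ℂ)))
      (ContinuousLinearMap.mul ℝ ℂ) = 0) : ν = 0 := by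
  have hcf : ∀ (m : Measure ℝ) (t : ℝ),
      ∫ s, Complex.exp (-Complex.I * ((t * s : ℝ) : ℂ)) ∂m = (starRingEnd ℂ) (charFun m t) := by
    intro m t
    rw [← charFun_eq_conj_neg, charFun_apply_real]
    congr 1; ext s; congr 1; push_cast; ring
  have h' : ∀ t : ℝ, (charFun ν.re.toJordanDecomposition.posPart t -
        charFun ν.re.toJordanDecomposition.negPart t) -
      (charFun ν.im.toJordanDecomposition.posPart t -
        charFun ν.im.toJordanDecomposition.negPart t) * Complex.I = 0 := by
    intro t
    have h1 := h t
    rw [integral_complexMeasure ν (by fun_prop) (C := 1) (fun s => by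
      rw [Complex.norm_exp]; simp)] at h1
    simp only [hcf] at h1
    have h2 := congrArg (starRingEnd ℂ) h1
    simpa [sub_eq_add_neg] using h2
  -- Conjugating the identity at `-t` restores the characteristic functions at `t` but flips the
  -- sign of `I`; together with `h'` this separates real and imaginary parts.
  have h'' : ∀ t : ℝ, (charFun ν.re.toJordanDecomposition.posPart t -
        charFun ν.re.toJordanDecomposition.negPart t) +
      (charFun ν.im.toJordanDecomposition.posPart t -
        charFun ν.im.toJordanDecomposition.negPart t) * Complex.I = 0 := by
    intro t
    have h1 := congrArg (starRingEnd ℂ) (h' (-t))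
    simp only [charFun_eq_conj_neg] at h1
    simpa [sub_eq_add_neg] using h1
  have e1 : ∀ t, charFun ν.re.toJordanDecomposition.posPart t =
      charFun ν.re.toJordanDecomposition.negPart t := fun t => by
    linear_combination (h' t + h'' t) / 2
  have e2 : ∀ t, charFun ν.im.toJordanDecomposition.posPart t =
      charFun ν.im.toJordanDecomposition.negPart t := fun t => by
    linear_combination (-Complex.I) * (h'' t - h' t) / 2 +
      (charFun ν.im.toJordanDecomposition.posPart t -
        charFun ν.im.toJordanDecomposition.negPart t) * Complex.I_sq
  exact complexMeasure_eq_zero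
    (signedMeasure_eq_zero_of_parts_eq (Measure.ext_of_charFun (funext e1)))
    (signedMeasure_eq_zero_of_parts_eq (Measure.ext_of_charFun (funext e2)))

end ComplexMeasures

/-! ### From Fourier data on lines to projections of positive measures. -/

section Radon

theorem fourierTransform_smul_dirVec (μ : ComplexMeasure Plane) (θ t : ℝ) :
    fourierTransform μ (t • dirVec θ) = VectorMeasure.integral (radon μ θ)
      (fun s : ℝ => Complex.exp (-Complex.I * ((t * s : ℝ) : ℂ)))
      (ContinuousLinearMap.mul ℝ ℂ) := by
  have hm : Measurable fun s : ℝ => Complex.exp (-Complex.I * ((t * s : ℝ) : ℂ)) := by fun_prop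
  rw [radon, VectorMeasure.integral_map (measurable_dirProj θ) hm.aestronglyMeasurable]
  · simp only [fourierTransform, dirProj, inner_smul_left, real_inner_comm (dirVec θ)]
    rfl
  · refine Integrable.of_bound (hm.comp (measurable_dirProj θ)).aestronglyMeasurable 1
      (Filter.Eventually.of_forall fun x => ?_)
    simp only [Function.comp]
    rw [Complex.norm_exp]
    simp

/-- The Radon projection in a direction vanishes if and only if the Fourier transform vanishes
on the line in this direction. -/
theorem fourierTransform_eq_zero_on_lineThrough_iff (μ : ComplexMeasure Plane) (θ : ℝ) :
    (∀ ξ ∈ lineThrough θ, fourierTransform μ ξ = 0) ↔ radon μ θ = 0 := by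
  constructor
  · intro h
    refine complexMeasure_eq_zero_of_integral_exp fun t => ?_
    rw [← fourierTransform_smul_dirVec]
    exact h _ ⟨t, rfl⟩
  · rintro h _ ⟨t, rfl⟩
    rw [fourierTransform_smul_dirVec, h, VectorMeasure.integral_zero_vectorMeasure]

/-- The Jordan parts are mutually singular, are carried by `Γ` because the total variation of `Γᶜ`
is zero, and have equal images because `s` vanishes on preimages. -/
theorem signedMeasure_eq_zero_of_determinedBy {Γ : Set Plane} (hΓ : MeasurableSet Γ)
    {f g : Plane → ℝ} (hf : Measurable f) (hg : Measurable g) (h : DeterminedBy Γ f g)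
    {s : SignedMeasure Plane} (hs : ∀ A, MeasurableSet A → Disjoint A Γ → s A = 0)
    (hsf : ∀ B, MeasurableSet B → s (f ⁻¹' B) = 0) (hsg : ∀ B, MeasurableSet B → s (g ⁻¹' B) = 0) :
    s = 0 := by
  have hv : s.totalVariation Γᶜ = 0 := by
    rw [s.totalVariation_eq_variation, VectorMeasure.variation_apply_eq_zero hΓ.compl]
    exact fun A hA hAm => hs A hAm (Set.disjoint_left.2 fun x hx hx' => hA hx hx')
  rw [SignedMeasure.totalVariation, Measure.add_apply, add_eq_zero] at hv
  have hmap : ∀ f : Plane → ℝ, Measurable f → (∀ B, MeasurableSet B → s (f ⁻¹' B) = 0) →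
      s.toJordanDecomposition.posPart.map f = s.toJordanDecomposition.negPart.map f := by
    intro f hf h
    ext B hB
    have := h B hB
    rw [s.apply_eq_posPart_real_sub_negPart_real (hf hB), sub_eq_zero] at this
    rw [Measure.map_apply hf hB, Measure.map_apply hf hB]
    exact (ENNReal.toReal_eq_toReal_iff' (measure_ne_top _ _) (measure_ne_top _ _)).1 this
  exact signedMeasure_eq_zero_of_parts_eq (h _ _ inferInstance inferInstance
    s.toJordanDecomposition.mutuallySingular hv.1 hv.2 (hmap f hf hsf) (hmap g hg hsg))

theorem eq_zero_of_radon_eq_zero {Γ : Set Plane} (hΓ : MeasurableSet Γ) {θ₁ θ₂ : ℝ}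
    (h : DeterminedBy Γ (dirProj θ₁) (dirProj θ₂)) {μ : ComplexMeasure Plane}
    (hμ : μ ∈ measuresOn Γ) (h₁ : radon μ θ₁ = 0) (h₂ : radon μ θ₂ = 0) : μ = 0 := by
  have hr : ∀ θ, radon μ θ = 0 → ∀ B, MeasurableSet B → μ (dirProj θ ⁻¹' B) = 0 := by
    intro θ hθ B hB
    rw [← radon_apply μ θ hB, hθ]
    rfl
  refine complexMeasure_eq_zero ?_ ?_
  · exact signedMeasure_eq_zero_of_determinedBy hΓ (measurable_dirProj _) (measurable_dirProj _) h
      (fun A hA hd => congrArg Complex.re (hμ A hA hd))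
      (fun B hB => congrArg Complex.re (hr _ h₁ B hB))
      (fun B hB => congrArg Complex.re (hr _ h₂ B hB))
  · exact signedMeasure_eq_zero_of_determinedBy hΓ (measurable_dirProj _) (measurable_dirProj _) h
      (fun A hA hd => congrArg Complex.im (hμ A hA hd))
      (fun B hB => congrArg Complex.im (hr _ h₁ B hB))
      (fun B hB => congrArg Complex.im (hr _ h₂ B hB))

theorem isHeisenbergUniquenessPair_of_determinedBy {Γ : Set Plane} (hΓ : MeasurableSet Γ)
    {θ₁ θ₂ : ℝ} (h : DeterminedBy Γ (dirProj θ₁) (dirProj θ₂)) :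
    IsHeisenbergUniquenessPair Γ (lineThrough θ₁ ∪ lineThrough θ₂) := fun μ hμ hF =>
  eq_zero_of_radon_eq_zero hΓ h hμ.1
    ((fourierTransform_eq_zero_on_lineThrough_iff μ θ₁).1 fun ξ hξ => hF ξ (Or.inl hξ))
    ((fourierTransform_eq_zero_on_lineThrough_iff μ θ₂).1 fun ξ hξ => hF ξ (Or.inr hξ))

end Radon

/-! ### From open sets of functionals to sets of angles. -/

section Angles

theorem continuous_dirVec : Continuous dirVec := by
  unfold dirVec
  refine (PiLp.continuous_toLp 2 _).comp (continuous_pi fun i => ?_)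
  fin_cases i
  · exact Real.continuous_cos
  · exact Real.continuous_sin

theorem inner_plane (x y : Plane) : inner ℝ x y = x 0 * y 0 + x 1 * y 1 := by
  simp [PiLp.inner_apply, Fin.sum_univ_two, mul_comm]

theorem exists_eq_smul_dirVec {w : Plane} (hw : w 0 ≠ 0) :
    ∃ r θ : ℝ, r ≠ 0 ∧ θ ∈ Set.Ioo (-(Real.pi / 2)) (Real.pi / 2) ∧ w = r • dirVec θ := by
  have hc := Real.cos_arctan_pos (w 1 / w 0)
  refine ⟨w 0 / Real.cos (Real.arctan (w 1 / w 0)), Real.arctan (w 1 / w 0),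
    div_ne_zero hw hc.ne', Real.arctan_mem_Ioo _, ?_⟩
  have ht : Real.sin (Real.arctan (w 1 / w 0)) =
      w 1 / w 0 * Real.cos (Real.arctan (w 1 / w 0)) := by
    rw [← Real.tan_mul_cos hc.ne', Real.tan_arctan]
  ext i
  fin_cases i
  · simp [dirVec]
    field_simp
  · simp [dirVec, ht]
    field_simp

/-- If the linear functionals in a nonempty open set of pairs of functionals determine the measures
on `Γ`, then there is a set of positive measure of pairs of angles with the uniqueness property. -/
theorem exists_isUniquenessAngleSet_of_isOpen {Γ : Set Plane} (hΓ : MeasurableSet Γ)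
    {U : Set (Plane × Plane)} (hU : IsOpen U) (hne : U.Nonempty)
    (h : ∀ w ∈ U, DeterminedBy Γ (fun x => inner ℝ x w.1) (fun x => inner ℝ x w.2)) :
    ∃ E, IsUniquenessAngleSet Γ E := by
  -- Angles in the open interval exclude vertical directions; a small horizontal shift inside `U`
  -- avoids them.
  obtain ⟨w, hw, hw1, hw2⟩ : ∃ w ∈ U, w.1 0 ≠ 0 ∧ w.2 0 ≠ 0 := by
    obtain ⟨w, hw⟩ := hne
    let e : Plane := EuclideanSpace.single 0 1
    let γ : ℝ → Plane × Plane := fun ε => (w.1 + ε • e, w.2 + ε • e)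
    have hγ : Continuous γ := by fun_prop
    have hmem : γ ⁻¹' U ∈ nhds (0 : ℝ) :=
      (hU.preimage hγ).mem_nhds (by simpa [γ] using hw)
    obtain ⟨ε, hε, hε'⟩ := ((infinite_of_mem_nhds (0 : ℝ) hmem).sdiff
      (Set.toFinite {-(w.1 0), -(w.2 0)})).nonempty
    simp only [Set.mem_insert_iff, Set.mem_singleton_iff, not_or] at hε'
    refine ⟨γ ε, hε, ?_, ?_⟩
    · intro h0
      simp [γ, e] at h0
      exact hε'.1 (by linarith)
    · intro h0
      simp [γ, e] at h0
      exact hε'.2 (by linarith)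
  obtain ⟨r₁, θ₁, hr₁, hθ₁, he₁⟩ := exists_eq_smul_dirVec hw1
  obtain ⟨r₂, θ₂, hr₂, hθ₂, he₂⟩ := exists_eq_smul_dirVec hw2
  -- The scalars `r₁`, `r₂` are frozen so that the angles alone parametrise; rescaling a functional
  -- does not affect determination.
  let φ : ℝ × ℝ → Plane × Plane := fun θ => (r₁ • dirVec θ.1, r₂ • dirVec θ.2)
  have hφ : Continuous φ :=
    ((continuous_dirVec.comp continuous_fst).const_smul r₁).prodMk
      ((continuous_dirVec.comp continuous_snd).const_smul r₂)
  have hopen : IsOpen (Set.Ioo (-(Real.pi / 2)) (Real.pi / 2) ×ˢ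
      Set.Ioo (-(Real.pi / 2)) (Real.pi / 2) ∩ φ ⁻¹' U) :=
    (isOpen_Ioo.prod isOpen_Ioo).inter (hU.preimage hφ)
  refine ⟨_, Set.inter_subset_left, hopen.measurableSet, hopen.measure_pos _
    ⟨(θ₁, θ₂), ⟨hθ₁, hθ₂⟩, ?_⟩, fun θ₁ θ₂ hθ => ?_⟩
  · simp only [Set.mem_preimage, φ, ← he₁, ← he₂]
    exact hw
  · refine isHeisenbergUniquenessPair_of_determinedBy hΓ
      (DeterminedBy.of_comp (φ := fun s => r₁ * s) (ψ := fun s => r₂ * s) ?_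
        (measurable_dirProj _) (measurable_dirProj _) (by fun_prop) (by fun_prop))
    simpa only [φ, inner_smul_right, dirProj] using h _ hθ.2

end Angles

/-! ### Graphs of powers of the absolute value. -/

section PowerGraph

theorem measurableSet_powerGraph (α : ℝ) : MeasurableSet (powerGraph α) :=
  measurableSet_eq_fun (by fun_prop) (by fun_prop)

/-- Normalised, the functionals are `x 1 + k * x 0` with slopes `k₁ > 0 > k₂`. The first is strictly
monotone along the right half of the graph, the second along the left half, and the sign of their
difference `(k₁ - k₂) * x 0` tells the halves apart. -/
theorem determinedBy_powerGraph {α : ℝ} (hα : 0 < α) {w₁ w₂ : Plane} (h₁ : 0 < w₁ 1)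
    (h₂ : 0 < w₂ 1) (h₁' : 0 < w₁ 0) (h₂' : w₂ 0 < 0) :
    DeterminedBy (powerGraph α) (fun x => inner ℝ x w₁) (fun x => inner ℝ x w₂) := by
  refine DeterminedBy.of_comp (φ := fun s => s / w₁ 1) (ψ := fun s => s / w₂ 1) ?_
    (by fun_prop) (by fun_prop) (by fun_prop) (by fun_prop)
  have hF : ∀ x w : Plane, 0 < w 1 → inner ℝ x w / w 1 = x 1 + w 0 / w 1 * x 0 := by
    intro x w hw
    rw [inner_plane]
    field_simp
    ring
  simp only [hF _ _ h₁, hF _ _ h₂]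
  have hk₁ : 0 < w₁ 0 / w₁ 1 := div_pos h₁' h₁
  have hk₂ : w₂ 0 / w₂ 1 < 0 := div_neg_of_neg_of_pos h₂' h₂
  generalize w₁ 0 / w₁ 1 = k₁ at *
  generalize w₂ 0 / w₂ 1 = k₂ at *
  have hext : ∀ x ∈ powerGraph α, ∀ y ∈ powerGraph α, x 0 = y 0 → x = y := by
    intro x hx y hy hxy
    ext i
    fin_cases i
    · exact hxy
    · change x 1 = y 1
      rw [show x 1 = _ from hx, show y 1 = _ from hy, hxy]
  have hmono : ∀ x ∈ powerGraph α, ∀ y ∈ powerGraph α, |x 0| < |y 0| → x 1 < y 1 := by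
    intro x hx y hy hxy
    rw [show x 1 = _ from hx, show y 1 = _ from hy]
    exact Real.rpow_lt_rpow (abs_nonneg _) hxy hα
  refine determinedBy_of_injOn (measurableSet_powerGraph α) (C := {x | 0 < x 0})
    (measurableSet_lt (by fun_prop) (by fun_prop)) (by fun_prop) (by fun_prop) ?_ ?_ ?_ ?_
  · rintro x ⟨hx, hx0 : 0 < x 0⟩ y ⟨hy, hy0 : 0 < y 0⟩ (hxy : x 1 + k₁ * x 0 = y 1 + k₁ * y 0)
    rcases lt_trichotomy (x 0) (y 0) with h | h | h
    · have := hmono x hx y hy (by rwa [abs_of_pos hx0, abs_of_pos hy0])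
      nlinarith
    · exact hext x hx y hy h
    · have := hmono y hy x hx (by rwa [abs_of_pos hx0, abs_of_pos hy0])
      nlinarith
  · rintro x ⟨hx, hx0 : ¬ 0 < x 0⟩ y ⟨hy, hy0 : ¬ 0 < y 0⟩
      (hxy : x 1 + k₂ * x 0 = y 1 + k₂ * y 0)
    rw [not_lt] at hx0 hy0
    rcases lt_trichotomy (x 0) (y 0) with h | h | h
    · have := hmono y hy x hx (by rw [abs_of_nonpos hx0, abs_of_nonpos hy0]; linarith)
      nlinarith
    · exact hext x hx y hy h
    · have := hmono x hx y hy (by rw [abs_of_nonpos hx0, abs_of_nonpos hy0]; linarith)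
      nlinarith
  · intro x _ (hx : 0 < x 0)
    nlinarith
  · intro x _ (hx : ¬ 0 < x 0)
    nlinarith

theorem exists_isUniquenessAngleSet_powerGraph {α : ℝ} (hα : 0 < α) :
    ∃ E, IsUniquenessAngleSet (powerGraph α) E := by
  refine exists_isUniquenessAngleSet_of_isOpen (measurableSet_powerGraph α)
    (U := {w | (0 < w.1 1 ∧ 0 < w.2 1) ∧ 0 < w.1 0 ∧ w.2 0 < 0}) ?_
    ⟨(!₂[1, 1], !₂[-1, 1]), by simp⟩
    fun w hw => determinedBy_powerGraph hα hw.1.1 hw.1.2 hw.2.1 hw.2.2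
  refine IsOpen.and (IsOpen.and ?_ ?_) (IsOpen.and ?_ ?_) <;>
    exact isOpen_lt (by fun_prop) (by fun_prop)

end PowerGraph

/-! ### Transport along affine equivalences. -/

section AffineImages

/-- The coefficients of the functional `⟨w, ·⟩` in the coordinates given by `T`. -/
theorem inner_affineEquiv (T : Plane ≃ᵃ[ℝ] Plane) (w x : Plane) :
    inner ℝ (T x) w = x 0 * inner ℝ (T.linear (EuclideanSpace.single 0 1)) w +
      x 1 * inner ℝ (T.linear (EuclideanSpace.single 1 1)) w + inner ℝ (T 0) w := by
  have h1 : T x = T.linear x + T 0 := by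
    have := T.map_vadd 0 x
    simpa using this
  have h2 : x = x 0 • EuclideanSpace.single 0 1 + x 1 • EuclideanSpace.single 1 1 := by
    ext i; fin_cases i <;> simp
  have h3 : T.linear x = x 0 • T.linear (EuclideanSpace.single 0 1) +
      x 1 • T.linear (EuclideanSpace.single 1 1) := by
    conv_lhs => rw [h2]
    simp
  rw [h1, h3]
  simp only [inner_add_left, inner_smul_left]
  rfl

theorem exists_inner_linear_eq (T : Plane ≃ᵃ[ℝ] Plane) (z : Plane) :
    ∃ w : Plane, inner ℝ (T.linear (EuclideanSpace.single 0 1)) w = z 0 ∧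
      inner ℝ (T.linear (EuclideanSpace.single 1 1)) w = z 1 := by
  refine ⟨LinearMap.adjoint (T.linear.symm : Plane →ₗ[ℝ] Plane) z, ?_, ?_⟩ <;>
  · rw [LinearMap.adjoint_inner_right]
    simp [inner_plane]

theorem continuous_affineEquiv (T : Plane ≃ᵃ[ℝ] Plane) : Continuous T :=
  T.toAffineMap.continuous_of_finiteDimensional

theorem measurableSet_affineEquiv_image (T : Plane ≃ᵃ[ℝ] Plane) {Γ : Set Plane}
    (hΓ : MeasurableSet Γ) : MeasurableSet (T '' Γ) := by
  rw [show T '' Γ = T.symm ⁻¹' Γ from T.toEquiv.image_eq_preimage_symm Γ]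
  exact (continuous_affineEquiv T.symm).measurable hΓ

theorem DeterminedBy.affineEquiv_image {T : Plane ≃ᵃ[ℝ] Plane} {Γ : Set Plane}
    {f g : Plane → ℝ} (hf : Measurable f) (hg : Measurable g)
    (h : DeterminedBy Γ (fun x => f (T x)) (fun x => g (T x))) : DeterminedBy (T '' Γ) f g := by
  intro p n hp hn hs hpΓ hnΓ hpf hpg
  have hT := (continuous_affineEquiv T).measurable
  have hT' := (continuous_affineEquiv T.symm).measurable
  let e : Plane ≃ᵐ Plane := ⟨T.toEquiv, hT, hT'⟩
  have hnull : ∀ m : Measure Plane, m (T '' Γ)ᶜ = 0 → m.map e.symm Γᶜ = 0 := by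
    intro m hm
    rw [e.symm.map_apply]
    convert hm using 2
    rw [← Set.image_compl_eq T.bijective]
    exact (T.toEquiv.image_eq_preimage_symm Γᶜ).symm
  have hmap : ∀ f : Plane → ℝ, Measurable f → ∀ m : Measure Plane,
      (m.map e.symm).map (fun x => f (T x)) = m.map f := by
    intro f hf m
    rw [Measure.map_map (show Measurable fun x => f (T x) from hf.comp hT) e.symm.measurable]
    congr 1
    ext x
    exact congrArg f (T.apply_symm_apply x)
  have key := h (p.map e.symm) (n.map e.symm) inferInstance inferInstance ?_ (hnull p hpΓ)
    (hnull n hnΓ) (by rw [hmap f hf, hmap f hf, hpf]) (by rw [hmap g hg, hmap g hg, hpg])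
  · have := congrArg (Measure.map e) key
    simpa [Measure.map_map e.measurable e.symm.measurable] using this
  · obtain ⟨S, hS, h1, h2⟩ := hs
    refine ⟨e ⁻¹' S, e.measurable hS, ?_, ?_⟩
    · rw [e.symm.map_apply]; simpa [← Set.preimage_comp] using h1
    · rw [e.symm.map_apply]; simpa [← Set.preimage_comp] using h2

end AffineImages

/-! ### Hyperbolas. -/

section Hyperbola

/-- Normalised, the functionals are `x 0 + k * x 1` with `|k| < 1`, whose level lines meet each
branch at most once. Their difference `(k₁ - k₂) * x 1` is positive on the upper branch and negative
on the lower. -/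
theorem determinedBy_hyperbola {a₁ b₁ c₁ a₂ b₂ c₂ : ℝ} (h₁ : |b₁| < a₁) (h₂ : |b₂| < a₂)
    (h : b₂ * a₁ < b₁ * a₂) :
    DeterminedBy {x : Plane | x 1 ^ 2 - x 0 ^ 2 = 1} (fun x => x 0 * a₁ + x 1 * b₁ + c₁)
      (fun x => x 0 * a₂ + x 1 * b₂ + c₂) := by
  have ha₁ : 0 < a₁ := (abs_nonneg _).trans_lt h₁
  have ha₂ : 0 < a₂ := (abs_nonneg _).trans_lt h₂
  refine DeterminedBy.of_comp (φ := fun s => (s - c₁) / a₁) (ψ := fun s => (s - c₂) / a₂) ?_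
    (by fun_prop) (by fun_prop) (by fun_prop) (by fun_prop)
  have hF : ∀ x : Plane, ∀ a b c : ℝ, 0 < a →
      (x 0 * a + x 1 * b + c - c) / a = x 0 + x 1 * (b / a) := by
    intro x a b c ha
    field_simp
    ring
  simp only [hF _ _ _ _ ha₁, hF _ _ _ _ ha₂]
  have hk : b₂ / a₂ < b₁ / a₁ := by rw [div_lt_div_iff₀ ha₂ ha₁]; exact h
  have hk₁ : |b₁ / a₁| < 1 := by rwa [abs_div, abs_of_pos ha₁, div_lt_one ha₁]
  have hk₂ : |b₂ / a₂| < 1 := by rwa [abs_div, abs_of_pos ha₂, div_lt_one ha₂]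
  generalize b₁ / a₁ = k₁ at *
  generalize b₂ / a₂ = k₂ at *
  have hinj : ∀ k : ℝ, |k| < 1 → ∀ x y : Plane, x 1 ^ 2 - x 0 ^ 2 = 1 → y 1 ^ 2 - y 0 ^ 2 = 1 →
      0 < x 1 * y 1 → x 0 + x 1 * k = y 0 + y 1 * k → x = y := by
    intro k hk x y hx hy hxy heq
    have hk' : k ^ 2 < 1 := (sq_lt_one_iff_abs_lt_one k).2 hk
    have h0 : x 0 - y 0 = k * (y 1 - x 1) := by linarith
    -- otherwise the slope of a chord of one branch would be at least one
    have h1 : x 1 = y 1 := by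
      by_contra hne
      have hd : 0 < (y 1 - x 1) ^ 2 := by
        have : y 1 - x 1 ≠ 0 := sub_ne_zero.2 (Ne.symm hne)
        positivity
      have h2 : (x 0 - y 0) ^ 2 < (y 1 - x 1) ^ 2 := by
        rw [h0]; nlinarith
      -- This is `h2` rewritten with the equation of the hyperbola; it contradicts the
      -- Cauchy–Schwarz bound `h4`, as `x 1 * y 1` is positive on a single branch.
      have h3 : x 1 * y 1 < 1 + x 0 * y 0 := by nlinarith
      have h4 : (1 + x 0 * y 0) ^ 2 ≤ (x 1 * y 1) ^ 2 := by
        have : (x 1 * y 1) ^ 2 = (1 + x 0 ^ 2) * (1 + y 0 ^ 2) := by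
          rw [mul_pow]
          congr 1 <;> linarith
        rw [this]
        nlinarith [sq_nonneg (x 0 - y 0)]
      nlinarith
    ext i
    fin_cases i
    · change x 0 = y 0
      rw [h1, sub_self, mul_zero] at h0
      linarith
    · exact h1
  have hne : ∀ x : Plane, x 1 ^ 2 - x 0 ^ 2 = 1 → x 1 ≠ 0 := by
    intro x hx h0
    rw [h0] at hx
    nlinarith [sq_nonneg (x 0)]
  have hC : MeasurableSet {x : Plane | 0 < x 1} :=
    measurableSet_lt (f := fun _ => (0 : ℝ)) (g := fun x : Plane => x 1)
      (by fun_prop) (by fun_prop)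
  refine determinedBy_of_injOn (measurableSet_eq_fun (by fun_prop) (by fun_prop)) hC
    (by fun_prop) (by fun_prop) ?_ ?_ ?_ ?_
  · rintro x ⟨hx, hx0 : 0 < x 1⟩ y ⟨hy, hy0 : 0 < y 1⟩ hxy
    exact hinj k₁ hk₁ x y hx hy (mul_pos hx0 hy0) hxy
  · rintro x ⟨hx, hx0 : ¬ 0 < x 1⟩ y ⟨hy, hy0 : ¬ 0 < y 1⟩ hxy
    exact hinj k₂ hk₂ x y hx hy (mul_pos_of_neg_of_neg (lt_of_le_of_ne (not_lt.1 hx0) (hne x hx))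
      (lt_of_le_of_ne (not_lt.1 hy0) (hne y hy))) hxy
  · intro x _ (hx : 0 < x 1)
    nlinarith
  · intro x _ (hx : ¬ 0 < x 1)
    nlinarith

theorem exists_isUniquenessAngleSet_hyperbola {Γ : Set Plane} (hΓ : IsHyperbola Γ) :
    ∃ E, IsUniquenessAngleSet Γ E := by
  obtain ⟨T, rfl⟩ := hΓ
  have hm : MeasurableSet {x : Plane | x 1 ^ 2 - x 0 ^ 2 = 1} :=
    measurableSet_eq_fun (by fun_prop) (by fun_prop)
  let a : Plane → ℝ := fun w => inner ℝ (T.linear (EuclideanSpace.single 0 1)) w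
  let b : Plane → ℝ := fun w => inner ℝ (T.linear (EuclideanSpace.single 1 1)) w
  have ha : Continuous a := by fun_prop
  have hb : Continuous b := by fun_prop
  refine exists_isUniquenessAngleSet_of_isOpen (measurableSet_affineEquiv_image T hm)
    (U := {w | (|b w.1| < a w.1 ∧ |b w.2| < a w.2) ∧ b w.2 * a w.1 < b w.1 * a w.2}) ?_ ?_
    fun w hw => ?_
  · refine IsOpen.and (IsOpen.and ?_ ?_) ?_ <;> exact isOpen_lt (by fun_prop) (by fun_prop)
  · obtain ⟨w₁, h₁, h₁'⟩ := exists_inner_linear_eq T !₂[2, 1]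
    obtain ⟨w₂, h₂, h₂'⟩ := exists_inner_linear_eq T !₂[2, 0]
    refine ⟨(w₁, w₂), ?_⟩
    simp only [Set.mem_ofPred_eq, a, b, h₁, h₁', h₂, h₂']
    norm_num
  · refine DeterminedBy.affineEquiv_image (by fun_prop) (by fun_prop) ?_
    rw [funext (inner_affineEquiv T w.1), funext (inner_affineEquiv T w.2)]
    exact determinedBy_hyperbola hw.1.1 hw.1.2 hw.2

end Hyperbola

/-! ### Boundaries of planar convex sets. -/

section ConvexBoundary

/-- The linear functional `⟨·, f⟩`, rescaled to take the values `0` at `w` and `1` at `v`. -/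
noncomputable def normalizedFunctional (v w f x : Plane) : ℝ :=
  (inner ℝ x f - inner ℝ w f) / (inner ℝ v f - inner ℝ w f)

theorem exists_support_frontier {K : Set Plane} (hK : Convex ℝ K) (hint : (interior K).Nonempty)
    {x : Plane} (hx : x ∈ frontier K) :
    ∃ φ : StrongDual ℝ Plane, (∀ a ∈ interior K, φ a < φ x) ∧ ∀ a ∈ K, φ a ≤ φ x := by
  obtain ⟨φ, hφ⟩ := geometric_hahn_banach_open_point hK.interior isOpen_interior hx.2
  refine ⟨φ, hφ, fun a ha => ?_⟩
  have hcl : a ∈ closure (interior K) := by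
    rw [hK.closure_interior_eq_closure_of_nonempty_interior hint]
    exact subset_closure ha
  exact closure_minimal (fun b hb => (hφ b hb).le)
    (isClosed_le φ.continuous continuous_const) hcl

theorem strongDual_plane_apply (φ : StrongDual ℝ Plane) (x : Plane) :
    φ x = x 0 * φ (EuclideanSpace.single 0 1) + x 1 * φ (EuclideanSpace.single 1 1) := by
  have h : x = x 0 • EuclideanSpace.single 0 1 + x 1 • EuclideanSpace.single 1 1 := by
    ext i; fin_cases i <;> simp
  conv_lhs => rw [h]
  simp

/-- A supporting functional in the coordinates `(F, F - G)`, where `w` and `v` become `(0, 0)` and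
`(1, 0)` and the line through them is the horizontal axis. Strictness on the interior keeps the
coefficients from both vanishing. -/
theorem exists_support_frontier_coordinates {K : Set Plane} (hK : Convex ℝ K)
    (hint : (interior K).Nonempty) {v w f g : Plane} (hf : inner ℝ w f < inner ℝ v f)
    (hg : inner ℝ w g < inner ℝ v g) (hfg : f 0 * g 1 - f 1 * g 0 ≠ 0) {x : Plane}
    (hx : x ∈ frontier K) :
    ∃ β γ : ℝ, (β ≠ 0 ∨ γ ≠ 0) ∧ ∀ a ∈ K,
      β * normalizedFunctional v w f a +
        γ * (normalizedFunctional v w f a - normalizedFunctional v w g a) ≤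
      β * normalizedFunctional v w f x +
        γ * (normalizedFunctional v w f x - normalizedFunctional v w g x) := by
  obtain ⟨φ, hφi, hφ⟩ := exists_support_frontier hK hint hx
  obtain ⟨m, k, h0, h1⟩ : ∃ m k : ℝ, φ (EuclideanSpace.single 0 1) = m * f 0 + k * g 0 ∧
      φ (EuclideanSpace.single 1 1) = m * f 1 + k * g 1 := by
    generalize φ (EuclideanSpace.single 0 1) = φ₀
    generalize φ (EuclideanSpace.single 1 1) = φ₁
    refine ⟨(φ₀ * g 1 - φ₁ * g 0) / (f 0 * g 1 - f 1 * g 0),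
      (f 0 * φ₁ - f 1 * φ₀) / (f 0 * g 1 - f 1 * g 0), ?_, ?_⟩
    · rw [div_mul_eq_mul_div, div_mul_eq_mul_div, ← add_div, eq_div_iff hfg]; ring
    · rw [div_mul_eq_mul_div, div_mul_eq_mul_div, ← add_div, eq_div_iff hfg]; ring
  have hval : ∀ a : Plane, φ a = m * inner ℝ a f + k * inner ℝ a g := by
    intro a
    rw [strongDual_plane_apply, h0, h1, inner_plane, inner_plane]
    ring
  have hf' : inner ℝ v f - inner ℝ w f ≠ 0 := (sub_pos.2 hf).ne'
  have hg' : inner ℝ v g - inner ℝ w g ≠ 0 := (sub_pos.2 hg).ne'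
  have hN : ∀ u a : Plane, inner ℝ v u - inner ℝ w u ≠ 0 → inner ℝ a u =
      (inner ℝ v u - inner ℝ w u) * normalizedFunctional v w u a + inner ℝ w u := by
    intro u a hu
    rw [normalizedFunctional, mul_div_cancel₀ _ hu]
    ring
  obtain ⟨c, β, γ, hφe⟩ : ∃ c β γ : ℝ, ∀ a, φ a = c + (β * normalizedFunctional v w f a +
      γ * (normalizedFunctional v w f a - normalizedFunctional v w g a)) := by
    refine ⟨m * inner ℝ w f + k * inner ℝ w g,
      m * (inner ℝ v f - inner ℝ w f) + k * (inner ℝ v g - inner ℝ w g),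
      -(k * (inner ℝ v g - inner ℝ w g)), fun a => ?_⟩
    rw [hval, hN f a hf', hN g a hg']
    ring
  refine ⟨β, γ, ?_, fun a ha => ?_⟩
  · by_contra h
    push Not at h
    obtain ⟨a, ha⟩ := hint
    have := hφi a ha
    rw [hφe a, hφe x, h.1, h.2] at this
    simp at this
  · have := hφ a ha
    rw [hφe a, hφe x] at this
    exact le_of_add_le_add_left this

theorem normalizedFunctional_right (v w f : Plane) : normalizedFunctional v w f w = 0 := by
  simp [normalizedFunctional]

theorem normalizedFunctional_left {v w f : Plane} (hf : inner ℝ w f < inner ℝ v f) :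
    normalizedFunctional v w f v = 1 :=
  div_self (sub_pos.2 hf).ne'

theorem measurable_normalizedFunctional (v w f : Plane) :
    Measurable (normalizedFunctional v w f) := by
  unfold normalizedFunctional
  fun_prop

theorem eq_of_normalizedFunctional_eq {v w f g : Plane} (hf : inner ℝ w f < inner ℝ v f)
    (hg : inner ℝ w g < inner ℝ v g) (hfg : f 0 * g 1 - f 1 * g 0 ≠ 0) {x y : Plane}
    (h₁ : normalizedFunctional v w f x = normalizedFunctional v w f y)
    (h₂ : normalizedFunctional v w g x = normalizedFunctional v w g y) : x = y := by
  have h : ∀ u : Plane, inner ℝ w u < inner ℝ v u →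
      normalizedFunctional v w u x = normalizedFunctional v w u y →
      x 0 * u 0 + x 1 * u 1 = y 0 * u 0 + y 1 * u 1 := by
    intro u hu h
    have := (div_left_inj' (sub_pos.2 hu).ne').1 h
    rw [← inner_plane, ← inner_plane]
    linarith
  have e₁ := h f hf h₁
  have e₂ := h g hg h₂
  ext i
  fin_cases i
  · change x 0 = y 0
    exact mul_right_cancel₀ hfg (by linear_combination g 1 * e₁ - f 1 * e₂)
  · change x 1 = y 1
    exact mul_right_cancel₀ hfg (by linear_combination f 0 * e₂ - g 0 * e₁)

/-- A functional in `c` and `l` that is maximal at `(c, l)` among `(0, 0)`, `(1, 0)` and `(c, l')`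
with `0 < l < l'` is trivial. -/
theorem support_trivial_of_pos {β γ c l l' : ℝ} (hc : 0 < c) (hc' : c < 1) (hl : 0 < l)
    (hl' : l < l') (h₀ : 0 ≤ β * c + γ * l) (h₁ : β ≤ β * c + γ * l)
    (h₂ : β * c + γ * l' ≤ β * c + γ * l) : β = 0 ∧ γ = 0 := by
  have hγ : γ ≤ 0 := by nlinarith
  -- Average `h₀` and `h₁` with weights `1 - c` and `c`.
  have hγ' : 0 ≤ γ * l := by nlinarith
  have hγ0 : γ = 0 := by nlinarith
  subst hγ0
  refine ⟨?_, rfl⟩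
  nlinarith

/-- A functional in `c` and `l` that is maximal at `(c, l)` among `(0, 0)`, `(1, 0)`, `(c, l')` and
`(c₀, l₀)` with `l' < l ≤ 0 < l₀` is trivial. -/
theorem support_trivial_of_nonpos {β γ c l l' c₀ l₀ : ℝ} (hc : 0 < c) (hc' : c < 1) (hl : l ≤ 0)
    (hl' : l' < l) (hl₀ : 0 < l₀) (h₀ : 0 ≤ β * c + γ * l) (h₁ : β ≤ β * c + γ * l)
    (h₂ : β * c + γ * l' ≤ β * c + γ * l) (h₃ : β * c₀ + γ * l₀ ≤ β * c + γ * l) :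
    β = 0 ∧ γ = 0 := by
  have hγ : 0 ≤ γ := by nlinarith
  have hγ' : 0 ≤ γ * l := by nlinarith
  have hγl : γ * l = 0 := le_antisymm (mul_nonpos_of_nonneg_of_nonpos hγ hl) hγ'
  rw [hγl, add_zero] at h₀ h₁ h₃
  have hβ : β = 0 := by nlinarith
  subst hβ
  refine ⟨rfl, ?_⟩
  nlinarith

/-- The chord from `w` to `v` is the line `F = G` and cuts the boundary into two arcs. A second
boundary point on the same side and the same level of `F` (above) or `G` (below) would put one of
the two inside the hull of the other and `v`, `w`, possibly with `a`. The point `a` above the chord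
is needed when the chord itself may lie on the boundary. -/
theorem determinedBy_frontier_of_exists_pos {K : Set Plane} (hK : Convex ℝ K) (hKc : IsClosed K)
    (hint : (interior K).Nonempty) {v w f g : Plane} (hv : v ∈ K) (hw : w ∈ K) (hvw : v ≠ w)
    (hfv : ∀ x ∈ K, x ≠ v → inner ℝ x f < inner ℝ v f)
    (hfw : ∀ x ∈ K, x ≠ w → inner ℝ w f < inner ℝ x f)
    (hgv : ∀ x ∈ K, x ≠ v → inner ℝ x g < inner ℝ v g)
    (hgw : ∀ x ∈ K, x ≠ w → inner ℝ w g < inner ℝ x g)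
    (hfg : f 0 * g 1 - f 1 * g 0 ≠ 0)
    (hpos : ∃ a ∈ K, normalizedFunctional v w g a < normalizedFunctional v w f a) :
    DeterminedBy (frontier K) (fun x => inner ℝ x f) (fun x => inner ℝ x g) := by
  have hf := hfw v hv hvw
  have hg := hgw v hv hvw
  refine DeterminedBy.of_comp
    (φ := fun s => (s - inner ℝ w f) / (inner ℝ v f - inner ℝ w f))
    (ψ := fun s => (s - inner ℝ w g) / (inner ℝ v g - inner ℝ w g)) ?_
    (by fun_prop) (by fun_prop) (by fun_prop) (by fun_prop)
  change DeterminedBy _ (normalizedFunctional v w f) (normalizedFunctional v w g)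
  have hFm := measurable_normalizedFunctional v w f
  have hGm := measurable_normalizedFunctional v w g
  have hsub : frontier K ⊆ K := hKc.frontier_subset
  have hsupp := fun x hx => exists_support_frontier_coordinates hK hint hf hg hfg (x := x) hx
  have hinj := fun x y => eq_of_normalizedFunctional_eq hf hg hfg (x := x) (y := y)
  have hFv := normalizedFunctional_left hf
  have hGv := normalizedFunctional_left hg
  have hFw := normalizedFunctional_right v w f
  have hGw := normalizedFunctional_right v w g
  have hlt : ∀ u : Plane, inner ℝ w u < inner ℝ v u →
      (∀ x ∈ K, x ≠ v → inner ℝ x u < inner ℝ v u) →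
      (∀ x ∈ K, x ≠ w → inner ℝ w u < inner ℝ x u) →
      (∀ x ∈ K, x ≠ v → normalizedFunctional v w u x < 1) ∧
      (∀ x ∈ K, x ≠ w → 0 < normalizedFunctional v w u x) := by
    intro u hu h₁ h₂
    constructor
    · intro x hx hxv
      rw [normalizedFunctional, div_lt_one (sub_pos.2 hu)]
      linarith [h₁ x hx hxv]
    · intro x hx hxw
      exact div_pos (sub_pos.2 (h₂ x hx hxw)) (sub_pos.2 hu)
  obtain ⟨hF1, hF0⟩ := hlt f hf hfv hfw
  obtain ⟨hG1, hG0⟩ := hlt g hg hgv hgw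
  generalize normalizedFunctional v w f = F at *
  generalize normalizedFunctional v w g = G at *
  obtain ⟨a, haK, ha⟩ := hpos
  have no_pos : ∀ x ∈ frontier K, ∀ y ∈ frontier K, F x = F y → 0 < F x - G x →
      F x - G x < F y - G y → False := by
    intro x hx y hy hxy hLx hLxy
    obtain ⟨β, γ, hne, hs⟩ := hsupp x hx
    have hxv : x ≠ v := by rintro rfl; linarith
    have hxw : x ≠ w := by rintro rfl; linarith
    have h0 := hs w hw
    have h1 := hs v hv
    have h2 := hs y (hsub hy)
    rw [hFw, hGw] at h0
    rw [hFv, hGv] at h1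
    rw [← hxy] at h2 hLxy
    have := support_trivial_of_pos (hF0 x (hsub hx) hxw) (hF1 x (hsub hx) hxv) hLx hLxy
      (by linarith) (by linarith) h2
    exact hne.elim (fun h => h this.1) (fun h => h this.2)
  have no_nonpos : ∀ x ∈ frontier K, ∀ y ∈ frontier K, y ≠ v → y ≠ w → G x = G y →
      F y - G y ≤ 0 → F x - G x < F y - G y → False := by
    intro x hx y hy hyv hyw hxy hLy hLxy
    obtain ⟨β, γ, hne, hs⟩ := hsupp y hy
    have h0 := hs w hw
    have h1 := hs v hv
    have h2 := hs x (hsub hx)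
    have h3 := hs a haK
    rw [hFw, hGw] at h0
    rw [hFv, hGv] at h1
    rw [hxy] at h2 hLxy
    -- Rewriting `β * F + γ * (F - G)` in the coordinates `(G, F - G)` changes the second
    -- coefficient to `β + γ`.
    have := support_trivial_of_nonpos (β := β) (γ := β + γ) (c₀ := G a)
      (hG0 y (hsub hy) hyw) (hG1 y (hsub hy) hyv) hLy
      hLxy (sub_pos.2 ha) (by linarith) (by linarith) (by linarith) (by linarith)
    have hγ : γ = 0 := by linarith [this.1, this.2]
    exact hne.elim (fun h => h this.1) (fun h => h hγ)
  have hCm : MeasurableSet {x | G x < F x} := measurableSet_lt hGm hFm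
  refine determinedBy_of_injOn isClosed_frontier.measurableSet hCm hFm hGm ?_ ?_
    (fun x _ hx => hx) (fun x _ hx => not_lt.1 hx)
  · rintro x ⟨hx, hLx : G x < F x⟩ y ⟨hy, hLy : G y < F y⟩ hxy
    rcases lt_trichotomy (F x - G x) (F y - G y) with h | h | h
    · exact (no_pos x hx y hy hxy (sub_pos.2 hLx) h).elim
    · exact hinj x y hxy (by linarith)
    · exact (no_pos y hy x hx hxy.symm (sub_pos.2 hLy) h).elim
  · rintro x ⟨hx, hLx : ¬ G x < F x⟩ y ⟨hy, hLy : ¬ G y < F y⟩ hxy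
    rw [not_lt] at hLx hLy
    -- The endpoints are alone on their levels of `G`, so they are treated separately; elsewhere `0
    -- < G < 1`.
    have hv' : ∀ z ∈ frontier K, G z = 1 → z = v := fun z hz h =>
      by_contra fun hzv => (hG1 z (hsub hz) hzv).ne h
    have hw' : ∀ z ∈ frontier K, G z = 0 → z = w := fun z hz h =>
      by_contra fun hzw => (hG0 z (hsub hz) hzw).ne' h
    by_cases hyv : y = v
    · rw [hyv, hGv] at hxy
      rw [hyv, hv' x hx hxy]
    by_cases hyw : y = w
    · rw [hyw, hGw] at hxy
      rw [hyw, hw' x hx hxy]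
    have hxv : x ≠ v := by
      rintro rfl
      exact hyv (hv' y hy (hxy.symm.trans hGv))
    have hxw : x ≠ w := by
      rintro rfl
      exact hyw (hw' y hy (hxy.symm.trans hGw))
    rcases lt_trichotomy (F x - G x) (F y - G y) with h | h | h
    · exact (no_nonpos x hx y hy hyv hyw hxy (by linarith) h).elim
    · exact hinj x y (by linarith) hxy
    · exact (no_nonpos y hy x hx hxv hxw hxy.symm (by linarith) h).elim

/-- The boundary of a convex set is determined by two independent functionals which attain their
strict maxima at the same point, and their strict minima at the same point. -/
theorem determinedBy_frontier {K : Set Plane} (hK : Convex ℝ K) (hKc : IsClosed K)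
    (hint : (interior K).Nonempty) {v w f g : Plane} (hv : v ∈ K) (hw : w ∈ K) (hvw : v ≠ w)
    (hfv : ∀ x ∈ K, x ≠ v → inner ℝ x f < inner ℝ v f)
    (hfw : ∀ x ∈ K, x ≠ w → inner ℝ w f < inner ℝ x f)
    (hgv : ∀ x ∈ K, x ≠ v → inner ℝ x g < inner ℝ v g)
    (hgw : ∀ x ∈ K, x ≠ w → inner ℝ w g < inner ℝ x g)
    (hfg : f 0 * g 1 - f 1 * g 0 ≠ 0) :
    DeterminedBy (frontier K) (fun x => inner ℝ x f) (fun x => inner ℝ x g) := by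
  by_cases h₁ : ∃ a ∈ K, normalizedFunctional v w g a < normalizedFunctional v w f a
  · exact determinedBy_frontier_of_exists_pos hK hKc hint hv hw hvw hfv hfw hgv hgw hfg h₁
  by_cases h₂ : ∃ a ∈ K, normalizedFunctional v w f a < normalizedFunctional v w g a
  · refine (determinedBy_frontier_of_exists_pos hK hKc hint hv hw hvw hgv hgw hfv hfw ?_ h₂).swap
    intro h
    exact hfg (by linarith)
  exfalso
  push Not at h₁ h₂
  have hf := sub_pos.2 (hfw v hv hvw)
  have hg := sub_pos.2 (hgw v hv hvw)
  have heq : ∀ a ∈ K, normalizedFunctional v w f a = normalizedFunctional v w g a :=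
    fun a ha => le_antisymm (h₁ a ha) (h₂ a ha)
  unfold normalizedFunctional at heq
  generalize inner ℝ v f - inner ℝ w f = r at *
  generalize inner ℝ v g - inner ℝ w g = s at *
  have heq' : ∀ a ∈ K, inner ℝ a (s • f - r • g) = s * inner ℝ w f - r * inner ℝ w g := by
    intro a ha
    have := heq a ha
    rw [div_eq_div_iff hf.ne' hg.ne'] at this
    rw [inner_sub_right, inner_smul_right, inner_smul_right]
    linarith
  obtain ⟨a, ha⟩ := hint
  -- If the normalised functionals agreed on `K`, then `s • f - r • g` would be constant there;
  -- moving from an interior point along this vector itself forces it to be zero, contrary to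
  -- independence.
  have hev : ∀ᶠ t : ℝ in nhdsWithin 0 (Set.Ioi 0), a + t • (s • f - r • g) ∈ K := by
    have hc : Continuous fun t : ℝ => a + t • (s • f - r • g) := by fun_prop
    refine nhdsWithin_le_nhds (hc.continuousAt.preimage_mem_nhds ?_)
    simpa using mem_interior_iff_mem_nhds.1 ha
  obtain ⟨t, htK, ht⟩ := (hev.and self_mem_nhdsWithin).exists
  have h := heq' _ htK
  rw [inner_add_left, heq' a (interior_subset ha), inner_smul_left, real_inner_self_eq_norm_sq] at h
  have h0 : s • f - r • g = 0 := by
    rw [← norm_eq_zero]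
    have ht' : t ≠ 0 := (show (0 : ℝ) < t from ht).ne'
    simpa [ht'] using h
  have c0 := congrArg (fun z : Plane => z 0) h0
  have c1 := congrArg (fun z : Plane => z 1) h0
  simp only [PiLp.sub_apply, PiLp.smul_apply, smul_eq_mul, PiLp.zero_apply] at c0 c1
  exact hfg (mul_left_cancel₀ hg.ne' (by linear_combination g 1 * c0 - g 0 * c1))

end ConvexBoundary

/-! ### Convex polygons. -/

section Polygon

theorem inner_lt_of_mem_convexHull {V : Set Plane} {v f : Plane}
    (h : ∀ x ∈ V, x ≠ v → inner ℝ x f < inner ℝ v f) :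
    ∀ x ∈ convexHull ℝ V, x ≠ v → inner ℝ x f < inner ℝ v f := by
  have hconv : Convex ℝ {x : Plane | x ≠ v → inner ℝ x f < inner ℝ v f} := by
    intro x hx y hy a b ha hb hab hne
    have hle : ∀ z : Plane, (z ≠ v → inner ℝ z f < inner ℝ v f) → inner ℝ z f ≤ inner ℝ v f := by
      intro z hz
      by_cases h : z = v
      · rw [h]
      · exact (hz h).le
    have hxle := hle x hx
    have hyle := hle y hy
    rw [inner_add_left, real_inner_smul_left, real_inner_smul_left]
    rcases ha.eq_or_lt with rfl | ha
    · have hb1 : b = 1 := by linarith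
      subst hb1
      simp only [zero_smul, one_smul, zero_add] at hne
      linarith [hy hne]
    rcases hb.eq_or_lt with rfl | hb
    · have ha1 : a = 1 := by linarith
      subst ha1
      simp only [zero_smul, one_smul, add_zero] at hne
      linarith [hx hne]
    by_cases hxv : x = v
    · have hyv : y ≠ v := by
        rintro rfl
        apply hne
        rw [hxv, ← add_smul, hab, one_smul]
      have := hy hyv
      have hb1 : a = 1 - b := by linarith
      subst hb1
      nlinarith
    · have := hx hxv
      have ha1 : b = 1 - a := by linarith
      subst ha1
      nlinarith
  exact fun x hx => convexHull_min (fun y hy => h y hy) hconv hx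

/-- Some linear functional separates the points of a finite set. -/
theorem exists_inner_injOn (V : Finset Plane) :
    ∃ f : Plane, ∀ x ∈ V, ∀ y ∈ V, x ≠ y → inner ℝ x f ≠ inner ℝ y f := by
  -- The functional `(1, s)` identifies `x` and `y` for at most this one `s`. If `x 1 = y 1`,
  -- division by zero merely excludes `s = 0`, and distinct points are separated anyway.
  let bad : Set ℝ := ⋃ x ∈ V, ⋃ y ∈ V, {-(x 0 - y 0) / (x 1 - y 1)}
  have hbad : bad.Finite :=
    V.finite_toSet.biUnion fun x _ => V.finite_toSet.biUnion fun y _ => Set.finite_singleton _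
  obtain ⟨s, hs⟩ := hbad.infinite_compl.nonempty
  refine ⟨!₂[1, s], fun x hx y hy hxy h => ?_⟩
  simp only [inner_plane, Matrix.cons_val_zero, Matrix.cons_val_one] at h
  by_cases h1 : x 1 = y 1
  · apply hxy
    rw [h1] at h
    ext i
    fin_cases i
    · change x 0 = y 0
      linarith
    · exact h1
  · apply hs
    refine Set.mem_biUnion hx (Set.mem_biUnion hy ?_)
    rw [Set.mem_singleton_iff, eq_div_iff (sub_ne_zero.2 h1)]
    linarith

theorem exists_isUniquenessAngleSet_convexPolygon {Γ : Set Plane} (hΓ : IsConvexPolygon Γ) :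
    ∃ E, IsUniquenessAngleSet Γ E := by
  obtain ⟨V, hint, rfl⟩ := hΓ
  have hVne : V.Nonempty := by
    rw [Finset.nonempty_iff_ne_empty]
    rintro rfl
    simp at hint
  have hK : Convex ℝ (convexHull ℝ (V : Set Plane)) := convex_convexHull ℝ _
  have hKc : IsClosed (convexHull ℝ (V : Set Plane)) :=
    (V.finite_toSet.isCompact_convexHull (𝕜 := ℝ)).isClosed
  obtain ⟨f₀, hf₀⟩ := exists_inner_injOn V
  obtain ⟨v, hv, hvmax⟩ := V.exists_max_image (fun x => inner ℝ x f₀) hVne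
  obtain ⟨w, hw, hwmin⟩ := V.exists_min_image (fun x => inner ℝ x f₀) hVne
  have hvw : v ≠ w := by
    rintro rfl
    have : (V : Set Plane) ⊆ {v} := fun x hx => by
      by_contra hxv
      exact hf₀ x hx v hv hxv (le_antisymm (hvmax x hx) (hwmin x hx))
    obtain ⟨a, ha⟩ := hint
    have h1 := interior_mono (convexHull_mono this) ha
    rw [convexHull_singleton, interior_singleton] at h1
    exact h1
  let U₀ : Set Plane := {f | ∀ x ∈ V, (x ≠ v → inner ℝ x f < inner ℝ v f) ∧
    (x ≠ w → inner ℝ w f < inner ℝ x f)}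
  have hU₀ : IsOpen U₀ := by
    have : U₀ = ⋂ x ∈ V, {f | (x ≠ v → inner ℝ x f < inner ℝ v f) ∧
        (x ≠ w → inner ℝ w f < inner ℝ x f)} := by
      ext f
      simp [U₀]
    rw [this]
    refine isOpen_biInter_finset fun x _ => IsOpen.and ?_ ?_
    · by_cases h : x = v
      · simp [h]
      · simp only [ne_eq, h, not_false_eq_true, forall_const]
        exact isOpen_lt (by fun_prop) (by fun_prop)
    · by_cases h : x = w
      · simp [h]
      · simp only [ne_eq, h, not_false_eq_true, forall_const]
        exact isOpen_lt (by fun_prop) (by fun_prop)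
  have hmem : f₀ ∈ U₀ := fun x hx =>
    ⟨fun h => lt_of_le_of_ne (hvmax x hx) (hf₀ x hx v hv h),
      fun h => lt_of_le_of_ne (hwmin x hx) (hf₀ w hw x hx h.symm)⟩
  refine exists_isUniquenessAngleSet_of_isOpen isClosed_frontier.measurableSet
    (U := {p | (p.1 ∈ U₀ ∧ p.2 ∈ U₀) ∧ p.1 0 * p.2 1 - p.1 1 * p.2 0 ≠ 0}) ?_ ?_ ?_
  · exact ((hU₀.preimage continuous_fst).and (hU₀.preimage continuous_snd)).and
      (isOpen_ne_fun (by fun_prop) (by fun_prop))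
  · have hev : ∀ᶠ t : ℝ in nhdsWithin 0 (Set.Ioi 0), f₀ + t • !₂[-(f₀ 1), f₀ 0] ∈ U₀ := by
      have hc : Continuous fun t : ℝ => f₀ + t • (!₂[-(f₀ 1), f₀ 0] : Plane) := by fun_prop
      refine nhdsWithin_le_nhds (hc.continuousAt.preimage_mem_nhds ?_)
      simpa using hU₀.mem_nhds hmem
    obtain ⟨t, htU, ht⟩ := (hev.and self_mem_nhdsWithin).exists
    refine ⟨(f₀, f₀ + t • !₂[-(f₀ 1), f₀ 0]), ⟨hmem, htU⟩, ?_⟩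
    have ht' : (0 : ℝ) < t := ht
    simp only [PiLp.add_apply, PiLp.smul_apply, Matrix.cons_val_zero,
      Matrix.cons_val_one, smul_eq_mul]
    have hne : 0 < f₀ 0 ^ 2 + f₀ 1 ^ 2 := by
      by_contra hle
      have h0 : f₀ 0 = 0 := by nlinarith [sq_nonneg (f₀ 0), sq_nonneg (f₀ 1)]
      have h1 : f₀ 1 = 0 := by nlinarith [sq_nonneg (f₀ 0), sq_nonneg (f₀ 1)]
      exact hf₀ v hv w hw hvw (by simp [inner_plane, h0, h1])
    have : f₀ 0 * (f₀ 1 + t * f₀ 0) - f₀ 1 * (f₀ 0 + t * -f₀ 1) = t * (f₀ 0 ^ 2 + f₀ 1 ^ 2) := by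
      ring
    rw [this]
    positivity
  · rintro ⟨f, g⟩ ⟨⟨hf, hg⟩, hfg⟩
    have hmin : ∀ f ∈ U₀, ∀ x ∈ convexHull ℝ (V : Set Plane), x ≠ w →
        inner ℝ w f < inner ℝ x f := by
      intro f hf x hx hxw
      have := inner_lt_of_mem_convexHull (f := -f)
        (fun x hx h => by simpa using (hf x hx).2 h) x hx hxw
      simpa using this
    have hmax : ∀ f ∈ U₀, ∀ x ∈ convexHull ℝ (V : Set Plane), x ≠ v →
        inner ℝ x f < inner ℝ v f := fun f hf =>
      inner_lt_of_mem_convexHull fun x hx => (hf x hx).1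
    exact determinedBy_frontier hK hKc hint (subset_convexHull ℝ _ hv) (subset_convexHull ℝ _ hw)
      hvw (hmax f hf) (hmin f hf) (hmax g hg) (hmin g hg) hfg

end Polygon

/-! ### The unit circle and its moments. -/

section Circle

/-- Finite measures on the circle are determined by their Fourier coefficients. -/
theorem measure_unitAddCircle_ext {μ ν : Measure UnitAddCircle} [IsFiniteMeasure μ]
    [IsFiniteMeasure ν]
    (h : ∀ n : ℤ, ∫ x, (fourier n x : ℂ) ∂μ = ∫ x, (fourier n x : ℂ) ∂ν) : μ = ν := by
  have hint : ∀ (m : Measure UnitAddCircle) [IsFiniteMeasure m] (f : C(UnitAddCircle, ℂ)),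
      Integrable f m := fun m _ f => Integrable.of_bound
    f.continuous.aestronglyMeasurable ‖f‖ (Filter.Eventually.of_forall f.norm_coe_le_norm)
  have hcont : ∀ (m : Measure UnitAddCircle) [IsFiniteMeasure m],
      Continuous fun f : C(UnitAddCircle, ℂ) => ∫ x, f x ∂m := by
    intro m _
    refine (LipschitzWith.of_dist_le_mul (K := ⟨m.real Set.univ, measureReal_nonneg⟩)
      fun f g => ?_).continuous
    rw [dist_eq_norm, dist_eq_norm, ← integral_sub (hint m f) (hint m g)]
    refine (norm_integral_le_of_norm_le_const (C := ‖f - g‖)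
      (Filter.Eventually.of_forall fun x => (f - g).norm_coe_le_norm x)).trans ?_
    exact (mul_comm _ _).le
  let N : Submodule ℂ C(UnitAddCircle, ℂ) :=
    { carrier := {f | ∫ x, f x ∂μ = ∫ x, f x ∂ν}
      add_mem' := by
        intro f g (hf : _ = _) (hg : _ = _)
        change ∫ x, (f x + g x) ∂μ = ∫ x, (f x + g x) ∂ν
        rw [integral_add (hint μ f) (hint μ g), integral_add (hint ν f) (hint ν g), hf, hg]
      zero_mem' := by simp
      smul_mem' := by
        intro c f (hf : _ = _)
        change ∫ x, c • f x ∂μ = ∫ x, c • f x ∂ν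
        rw [integral_smul, integral_smul, hf] }
  have hN : IsClosed (N : Set C(UnitAddCircle, ℂ)) := isClosed_eq (hcont μ) (hcont ν)
  have htop : N = ⊤ := by
    rw [eq_top_iff, ← span_fourier_closure_eq_top]
    refine Submodule.topologicalClosure_minimal _ (Submodule.span_le.2 ?_) hN
    rintro _ ⟨n, rfl⟩
    exact h n
  refine ext_of_forall_integral_eq_of_IsFiniteMeasure fun f => ?_
  have hf : (⟨fun x => (f x : ℂ), by fun_prop⟩ : C(UnitAddCircle, ℂ)) ∈ N := by
    rw [htop]; trivial
  have hcomplex : ∫ x, (f x : ℂ) ∂μ = ∫ x, (f x : ℂ) ∂ν := hf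
  rw [integral_complex_ofReal, integral_complex_ofReal] at hcomplex
  exact Complex.ofReal_injective hcomplex

/-- The real part of `u ^ k` is a function of the real part and the absolute value of `u`. -/
theorem exists_re_pow_eq (N : ℝ) (k : ℕ) : ∃ P : ℝ → ℝ, Continuous P ∧
    ∀ u : ℂ, Complex.normSq u = N → (u ^ k).re = P u.re := by
  induction k using Nat.twoStepInduction with
  | zero => exact ⟨fun _ => 1, continuous_const, fun u _ => by simp⟩
  | one => exact ⟨fun s => s, continuous_id, fun u _ => by simp⟩
  | more k ih₁ ih₂ =>
    obtain ⟨P, hP, hP'⟩ := ih₁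
    obtain ⟨Q, hQ, hQ'⟩ := ih₂
    -- The Chebyshev-type recurrence `u ^ (k + 2) = 2 * Re u * u ^ (k + 1) - |u|² * u ^ k`.
    refine ⟨fun s => 2 * s * Q s - N * P s, by fun_prop, fun u hu => ?_⟩
    change _ = 2 * u.re * Q u.re - N * P u.re
    rw [← hQ' u hu, ← hP' u hu, ← hu, pow_succ, pow_succ, Complex.normSq_apply]
    simp only [Complex.mul_re, Complex.mul_im]
    ring

/-- The plane as the complex numbers. -/
def planeToComplex (x : Plane) : ℂ := ⟨x 0, x 1⟩

theorem continuous_planeToComplex : Continuous planeToComplex := by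
  have : planeToComplex = fun x => ((x 0 : ℝ) : ℂ) + (x 1 : ℝ) * Complex.I := by
    ext x
    exact Complex.mk_eq_add_mul_I _ _
  rw [this]
  fun_prop

/-- The unit circle. -/
def planeCircle : Set Plane := {x | x 0 ^ 2 + x 1 ^ 2 = 1}

theorem measurableSet_planeCircle : MeasurableSet planeCircle :=
  measurableSet_eq_fun (by fun_prop) (by fun_prop)

theorem normSq_planeToComplex {x : Plane} (hx : x ∈ planeCircle) :
    Complex.normSq (planeToComplex x) = 1 := by
  rw [Complex.normSq_apply, ← show x 0 ^ 2 + x 1 ^ 2 = 1 from hx]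
  simp only [planeToComplex]
  ring

theorem norm_planeToComplex {x : Plane} (hx : x ∈ planeCircle) : ‖planeToComplex x‖ = 1 := by
  have h := normSq_planeToComplex hx
  rw [Complex.normSq_eq_norm_sq] at h
  exact (pow_eq_one_iff_of_nonneg (norm_nonneg _) two_ne_zero).1 h

theorem integrable_planeToComplex_pow {p : Measure Plane} [IsFiniteMeasure p]
    (hp : p planeCircleᶜ = 0) (k : ℕ) : Integrable (fun x => planeToComplex x ^ k) p := by
  refine Integrable.of_bound (continuous_planeToComplex.pow k).aestronglyMeasurable 1 ?_
  have : ∀ᵐ x ∂p, x ∈ planeCircle := hp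
  filter_upwards [this] with x hx
  rw [norm_pow, norm_planeToComplex hx, one_pow]

/-- The scalar product with `(a, b)` is the real part of `conj (a + b i) * z`, which has constant
modulus on the circle, so the real part of each of its powers is a function of the projection. -/
theorem integral_re_pow_eq {p n : Measure Plane} (hp : p planeCircleᶜ = 0)
    (hn : n planeCircleᶜ = 0) {a b c : ℝ}
    (h : p.map (fun x => x 0 * a + x 1 * b + c) = n.map (fun x => x 0 * a + x 1 * b + c)) (k : ℕ) :
    ∫ x, (((starRingEnd ℂ) ⟨a, b⟩ * planeToComplex x) ^ k).re ∂p =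
      ∫ x, (((starRingEnd ℂ) ⟨a, b⟩ * planeToComplex x) ^ k).re ∂n := by
  obtain ⟨P, hP, hP'⟩ := exists_re_pow_eq (Complex.normSq ⟨a, b⟩) k
  have key : ∀ m : Measure Plane, m planeCircleᶜ = 0 →
      ∫ x, (((starRingEnd ℂ) ⟨a, b⟩ * planeToComplex x) ^ k).re ∂m =
      ∫ s, P (s - c) ∂(m.map (fun x => x 0 * a + x 1 * b + c)) := by
    intro m hm
    have hc : Continuous fun s => P (s - c) := by fun_prop
    rw [integral_map (by fun_prop) hc.aestronglyMeasurable]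
    refine integral_congr_ae ?_
    have : ∀ᵐ x ∂m, x ∈ planeCircle := hm
    filter_upwards [this] with x hx
    rw [hP' _ (by rw [Complex.normSq_mul, Complex.normSq_conj, normSq_planeToComplex hx, mul_one])]
    congr 1
    simp [planeToComplex]
    ring
  rw [key p hp, key n hn, h]

theorem integral_planeToComplex_pow_eq {p n : Measure Plane} [IsFiniteMeasure p]
    [IsFiniteMeasure n] (hp : p planeCircleᶜ = 0) (hn : n planeCircleᶜ = 0)
    {a₁ b₁ c₁ a₂ b₂ c₂ : ℝ}
    (hz : ∀ k : ℕ, (((starRingEnd ℂ) ⟨a₁, b₁⟩ * ⟨a₂, b₂⟩ : ℂ) ^ (k + 1)).im ≠ 0)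
    (h₁ : p.map (fun x => x 0 * a₁ + x 1 * b₁ + c₁) = n.map (fun x => x 0 * a₁ + x 1 * b₁ + c₁))
    (h₂ : p.map (fun x => x 0 * a₂ + x 1 * b₂ + c₂) = n.map (fun x => x 0 * a₂ + x 1 * b₂ + c₂))
    (k : ℕ) : ∫ x, planeToComplex x ^ k ∂p = ∫ x, planeToComplex x ^ k ∂n := by
  have hre : ∀ (m : Measure Plane) [IsFiniteMeasure m], m planeCircleᶜ = 0 → ∀ z : ℂ,
      ∫ x, (((starRingEnd ℂ) z * planeToComplex x) ^ k).re ∂m =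
        (z ^ k).re * (∫ x, planeToComplex x ^ k ∂m).re +
          (z ^ k).im * (∫ x, planeToComplex x ^ k ∂m).im := by
    intro m _ hm z
    have h1 : ∫ x, ((starRingEnd ℂ) z * planeToComplex x) ^ k ∂m =
        (starRingEnd ℂ) (z ^ k) * ∫ x, planeToComplex x ^ k ∂m := by
      rw [← integral_const_mul]
      simp only [mul_pow, map_pow]
    have hi : Integrable (fun x => ((starRingEnd ℂ) z * planeToComplex x) ^ k) m := by
      simp only [mul_pow]
      exact (integrable_planeToComplex_pow hm k).const_mul _
    have h2 := integral_re hi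
    simp only [RCLike.re_to_complex] at h2
    rw [h2, h1, Complex.mul_re, Complex.conj_re, Complex.conj_im]
    ring
  have e₁ := integral_re_pow_eq hp hn h₁ k
  have e₂ := integral_re_pow_eq hp hn h₂ k
  rw [hre p hp, hre n hn] at e₁ e₂
  -- For `k = 0` the determinant vanishes, but the moments are real total masses and one equation
  -- suffices. For higher powers Cramer's rule applies.
  cases k with
  | zero =>
    simp only [pow_zero, Complex.one_re, Complex.one_im, one_mul, zero_mul, add_zero] at e₁
    refine Complex.ext (by simpa using e₁) (by simp)
  | succ k =>
    have hdet := hz k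
    rw [mul_pow, ← map_pow] at hdet
    generalize (⟨a₁, b₁⟩ : ℂ) ^ (k + 1) = u₁ at *
    generalize (⟨a₂, b₂⟩ : ℂ) ^ (k + 1) = u₂ at *
    simp only [Complex.mul_im, Complex.conj_re, Complex.conj_im] at hdet
    refine Complex.ext (mul_left_cancel₀ hdet ?_) (mul_left_cancel₀ hdet ?_)
    · linear_combination u₂.im * e₁ - u₁.im * e₂
    · linear_combination u₁.re * e₂ - u₂.re * e₁

/-- The angular coordinate of a point of the plane. -/
noncomputable def planeAngle (x : Plane) : UnitAddCircle :=
  (((planeToComplex x).arg / (2 * Real.pi) : ℝ) : UnitAddCircle)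

theorem measurable_planeAngle : Measurable planeAngle := by
  have h1 : Measurable fun x => (planeToComplex x).arg / (2 * Real.pi) :=
    (Complex.measurable_arg.comp continuous_planeToComplex.measurable).div_const _
  exact (AddCircle.continuous_mk' (1 : ℝ)).measurable.comp h1

theorem fourier_planeAngle {x : Plane} (hx : x ∈ planeCircle) (n : ℤ) :
    (fourier n (planeAngle x) : ℂ) = planeToComplex x ^ n := by
  have h : planeToComplex x = Complex.exp ((planeToComplex x).arg * Complex.I) := by
    have := Complex.norm_mul_exp_arg_mul_I (planeToComplex x)
    rw [norm_planeToComplex hx] at this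
    simpa using this.symm
  rw [planeAngle, fourier_coe_apply]
  conv_rhs => rw [h]
  rw [← Complex.exp_int_mul]
  congr 1
  have : (Real.pi : ℂ) ≠ 0 := by exact_mod_cast Real.pi_ne_zero
  push_cast
  field_simp

theorem injOn_planeAngle : Set.InjOn planeAngle planeCircle := by
  intro x hx y hy hxy
  have h := congrArg (fun t => (fourier 1 t : ℂ)) hxy
  simp only [fourier_planeAngle hx, fourier_planeAngle hy, zpow_one] at h
  ext i
  fin_cases i
  · exact congrArg Complex.re h
  · exact congrArg Complex.im h

/-- Equal moments give equal Fourier coefficients of the angular images; negative ones follow by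
conjugation because the measures are positive. -/
theorem determinedBy_planeCircle {a₁ b₁ c₁ a₂ b₂ c₂ : ℝ}
    (hz : ∀ k : ℕ, (((starRingEnd ℂ) ⟨a₁, b₁⟩ * ⟨a₂, b₂⟩ : ℂ) ^ (k + 1)).im ≠ 0) :
    DeterminedBy planeCircle (fun x => x 0 * a₁ + x 1 * b₁ + c₁)
      (fun x => x 0 * a₂ + x 1 * b₂ + c₂) := by
  intro p n _ _ hs hp hn h₁ h₂
  refine eq_of_map_eq_of_injOn hs measurableSet_planeCircle hp hn measurable_planeAngle ?_
    injOn_planeAngle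
  refine measure_unitAddCircle_ext fun j => ?_
  have key : ∀ m : Measure Plane, m planeCircleᶜ = 0 →
      ∫ t, (fourier j t : ℂ) ∂(m.map planeAngle) = ∫ x, planeToComplex x ^ j ∂m := by
    intro m hm
    rw [integral_map measurable_planeAngle.aemeasurable
      (map_continuous (fourier j)).aestronglyMeasurable]
    refine integral_congr_ae ?_
    have : ∀ᵐ x ∂m, x ∈ planeCircle := hm
    filter_upwards [this] with x hx using fourier_planeAngle hx j
  rw [key p hp, key n hn]
  have hk := integral_planeToComplex_pow_eq hp hn hz h₁ h₂
  obtain ⟨k, rfl | rfl⟩ := j.eq_nat_or_neg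
  · simpa using hk k
  · have conj : ∀ m : Measure Plane, m planeCircleᶜ = 0 →
        ∫ x, planeToComplex x ^ (-(k : ℤ)) ∂m = (starRingEnd ℂ) (∫ x, planeToComplex x ^ k ∂m) := by
      intro m hm
      rw [← integral_conj]
      refine integral_congr_ae ?_
      have : ∀ᵐ x ∂m, x ∈ planeCircle := hm
      filter_upwards [this] with x hx
      rw [zpow_neg, zpow_natCast, map_pow, ← inv_pow,
        Complex.inv_def, normSq_planeToComplex hx]
      simp
    rw [conj p hp, conj n hn, hk]

end Circle

/-! ### Ellipses and the null set of exceptional angles. -/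

section Ellipse

theorem countable_setOf_pow_succ_eq_one : {ζ : ℂ | ∃ k : ℕ, ζ ^ (k + 1) = 1}.Countable := by
  have : {ζ : ℂ | ∃ k : ℕ, ζ ^ (k + 1) = 1} = ⋃ k : ℕ, {ζ : ℂ | ζ ^ (k + 1) = 1} := by
    ext; simp
  rw [this]
  refine Set.countable_iUnion fun k => Set.Finite.countable ?_
  refine (Polynomial.nthRoots (k + 1) (1 : ℂ)).toFinset.finite_toSet.subset fun ζ hζ => ?_
  simpa [Polynomial.mem_nthRoots] using hζ

theorem div_conj_pow_eq_one {u : ℂ} (hu : u ≠ 0) {k : ℕ} (h : (u ^ k).im = 0) :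
    (u / (starRingEnd ℂ) u) ^ k = 1 := by
  rw [div_pow, ← map_pow, Complex.conj_eq_iff_im.2 h, div_self (pow_ne_zero _ hu)]

/-- The functional `⟨·, (cos θ, sin θ)⟩` in the coordinates given by `T`, as a complex number. -/
noncomputable def angleCoefficient (T : Plane ≃ᵃ[ℝ] Plane) (θ : ℝ) : ℂ :=
  ⟨inner ℝ (T.linear (EuclideanSpace.single 0 1)) (dirVec θ),
    inner ℝ (T.linear (EuclideanSpace.single 1 1)) (dirVec θ)⟩

theorem continuous_angleCoefficient (T : Plane ≃ᵃ[ℝ] Plane) : Continuous (angleCoefficient T) := by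
  have : angleCoefficient T = fun θ =>
      ((inner ℝ (T.linear (EuclideanSpace.single 0 1)) (dirVec θ) : ℝ) : ℂ) +
      (inner ℝ (T.linear (EuclideanSpace.single 1 1)) (dirVec θ) : ℝ) * Complex.I := by
    ext x
    exact Complex.mk_eq_add_mul_I _ _
  rw [this]
  have := continuous_dirVec
  fun_prop

theorem exists_im_conj_angleCoefficient_mul (T : Plane ≃ᵃ[ℝ] Plane) : ∃ d : ℝ, d ≠ 0 ∧
    ∀ θ θ' : ℝ, ((starRingEnd ℂ) (angleCoefficient T θ) * angleCoefficient T θ').im =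
      d * Real.sin (θ' - θ) := by
  obtain ⟨w, hw, hw'⟩ := exists_inner_linear_eq T !₂[1, 0]
  obtain ⟨v, hv, hv'⟩ := exists_inner_linear_eq T !₂[0, 1]
  simp only [inner_plane, Matrix.cons_val_zero, Matrix.cons_val_one] at hw hw' hv hv'
  simp only [angleCoefficient, inner_plane]
  generalize T.linear (EuclideanSpace.single 0 1) = x at *
  generalize T.linear (EuclideanSpace.single 1 1) = y at *
  -- The determinant of the linear part of `T`; it is nonzero because `w`, `v` form a basis dual to
  -- `x`, `y`.
  refine ⟨x 0 * y 1 - x 1 * y 0, ?_, fun θ θ' => ?_⟩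
  · intro h
    have : (x 0 * y 1 - x 1 * y 0) * (w 0 * v 1 - w 1 * v 0) = 1 := by
      calc _ = (x 0 * w 0 + x 1 * w 1) * (y 0 * v 0 + y 1 * v 1) -
            (y 0 * w 0 + y 1 * w 1) * (x 0 * v 0 + x 1 * v 1) := by ring
        _ = 1 := by rw [hw, hw', hv, hv']; norm_num
    rw [h, zero_mul] at this
    exact zero_ne_one this
  · simp only [dirVec, Real.sin_sub, Complex.mul_im, Complex.conj_re, Complex.conj_im,
      Matrix.cons_val_zero, Matrix.cons_val_one]
    ring

theorem angleCoefficient_ne_zero (T : Plane ≃ᵃ[ℝ] Plane) (θ : ℝ) : angleCoefficient T θ ≠ 0 := by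
  obtain ⟨d, hd, h⟩ := exists_im_conj_angleCoefficient_mul T
  intro h0
  have := h θ (θ + Real.pi / 2)
  rw [h0] at this
  simp only [map_zero, zero_mul, Complex.zero_im, add_sub_cancel_left, Real.sin_pi_div_two,
    mul_one] at this
  exact hd this.symm

/-- An exceptional `θ'` makes `u / conj u` a root of unity, where `u` is the product of
coefficients. For fixed `θ` this quotient is injective in `θ'`, since equal values at `s`, `t` force
`sin (s - t) = 0`. -/
theorem countable_setOf_angle (T : Plane ≃ᵃ[ℝ] Plane) (θ : ℝ) :
    (Set.Ioo (-(Real.pi / 2)) (Real.pi / 2) ∩ {θ' | ∃ k : ℕ,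
      (((starRingEnd ℂ) (angleCoefficient T θ) * angleCoefficient T θ') ^ (k + 1)).im =
        0}).Countable := by
  obtain ⟨d, hd, hsin⟩ := exists_im_conj_angleCoefficient_mul T
  set z := angleCoefficient T with hz
  have hz0 : ∀ θ, z θ ≠ 0 := angleCoefficient_ne_zero T
  have hu : ∀ θ', (starRingEnd ℂ) (z θ) * z θ' ≠ 0 := fun θ' =>
    mul_ne_zero ((map_ne_zero _).2 (hz0 θ)) (hz0 θ')
  let ρ : ℝ → ℂ := fun θ' =>
    ((starRingEnd ℂ) (z θ) * z θ') / (starRingEnd ℂ) ((starRingEnd ℂ) (z θ) * z θ')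
  have hinj : Set.InjOn ρ (Set.Ioo (-(Real.pi / 2)) (Real.pi / 2)) := by
    intro s hs t ht hst
    have h1 := (div_eq_div_iff ((map_ne_zero _).2 (hu s)) ((map_ne_zero _).2 (hu t))).1 hst
    have h2 : (starRingEnd ℂ) (z t) * z s = (starRingEnd ℂ) ((starRingEnd ℂ) (z t) * z s) := by
      simp only [map_mul, Complex.conj_conj] at h1 ⊢
      refine mul_left_cancel₀ (mul_ne_zero (hz0 θ) ((map_ne_zero (starRingEnd ℂ)).2 (hz0 θ))) ?_
      linear_combination h1
    have h3 := Complex.conj_eq_iff_im.1 h2.symm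
    rw [hsin t s] at h3
    have h4 : Real.sin (s - t) = 0 := (mul_eq_zero.1 h3).resolve_left hd
    have h5 := (Real.sin_eq_zero_iff_of_lt_of_lt (by linarith [hs.1, ht.2])
      (by linarith [hs.2, ht.1])).1 h4
    linarith
  refine (Set.MapsTo.countable_of_injOn (f := ρ) ?_ (hinj.mono Set.inter_subset_left)
    countable_setOf_pow_succ_eq_one)
  rintro θ' ⟨_, k, hk⟩
  exact ⟨k, div_conj_pow_eq_one (hu θ') hk⟩

theorem exists_isUniquenessAngleSet_ellipse {Γ : Set Plane} (hΓ : IsEllipse Γ) :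
    ∃ E, IsUniquenessAngleSet Γ E := by
  obtain ⟨T, rfl⟩ := hΓ
  let Q : Set (ℝ × ℝ) := Set.Ioo (-(Real.pi / 2)) (Real.pi / 2) ×ˢ
    Set.Ioo (-(Real.pi / 2)) (Real.pi / 2)
  let B : Set (ℝ × ℝ) := {θ | ∃ k : ℕ, (((starRingEnd ℂ) (angleCoefficient T θ.1) *
    angleCoefficient T θ.2) ^ (k + 1)).im = 0}
  have hQ : IsOpen Q := isOpen_Ioo.prod isOpen_Ioo
  have hB : MeasurableSet B := by
    have : B = ⋃ k : ℕ, {θ : ℝ × ℝ | (((starRingEnd ℂ) (angleCoefficient T θ.1) *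
        angleCoefficient T θ.2) ^ (k + 1)).im = 0} := by
      ext; simp [B]
    rw [this]
    refine MeasurableSet.iUnion fun k => (isClosed_eq ?_ continuous_const).measurableSet
    have h₁ := (continuous_angleCoefficient T).comp (continuous_fst (X := ℝ) (Y := ℝ))
    have h₂ := (continuous_angleCoefficient T).comp (continuous_snd (X := ℝ) (Y := ℝ))
    exact Complex.continuous_im.comp (((Complex.continuous_conj.comp h₁).mul h₂).pow (k + 1))
  -- By Fubini: each vertical slice of the exceptional set is countable.
  have hnull : volume (Q ∩ B) = 0 := by
    rw [Measure.volume_eq_prod, Measure.measure_prod_null (hQ.measurableSet.inter hB)]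
    refine Filter.Eventually.of_forall fun θ => ?_
    refine ((countable_setOf_angle T θ).mono ?_).measure_zero volume
    rintro θ' ⟨hθ, hθ'⟩
    exact ⟨hθ.2, hθ'⟩
  refine ⟨Q \ B, Set.sdiff_subset, hQ.measurableSet.diff hB, ?_, fun θ₁ θ₂ hθ => ?_⟩
  · rw [measure_sdiff_null' hnull]
    refine hQ.measure_pos _ ⟨(0, 0), ?_⟩
    have := Real.pi_pos
    simp [Q, this]
  · refine isHeisenbergUniquenessPair_of_determinedBy
      (measurableSet_affineEquiv_image T measurableSet_planeCircle)
      (DeterminedBy.affineEquiv_image (measurable_dirProj _) (measurable_dirProj _) ?_)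
    simp only [dirProj]
    rw [funext (inner_affineEquiv T (dirVec θ₁)), funext (inner_affineEquiv T (dirVec θ₂))]
    exact determinedBy_planeCircle fun k hk => hθ.2 ⟨k, hk⟩

end Ellipse

theorem mainTheorem11 (Γ : Set Plane) (hΓ : IsAdmissibleCurve Γ) :
    (∃ E : Set (ℝ × ℝ), IsUniquenessAngleSet Γ E) ∧
      ∀ E : Set (ℝ × ℝ), IsUniquenessAngleSet Γ E →
        ∀ θ₁ θ₂ : ℝ, (θ₁, θ₂) ∈ E →
          ∀ μ ∈ acMeasures Γ, radon μ θ₁ = 0 → radon μ θ₂ = 0 → μ = 0 := by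
  refine ⟨?_, fun E hE θ₁ θ₂ hθ μ hμ h₁ h₂ => hE.isHUP θ₁ θ₂ hθ μ hμ ?_⟩
  · obtain ⟨α, hα, rfl⟩ | h | h | h := hΓ
    · exact exists_isUniquenessAngleSet_powerGraph hα
    · exact exists_isUniquenessAngleSet_hyperbola h
    · exact exists_isUniquenessAngleSet_convexPolygon h
    · exact exists_isUniquenessAngleSet_ellipse h
  · rintro ξ (hξ | hξ)
    · exact (fourierTransform_eq_zero_on_lineThrough_iff μ θ₁).2 h₁ ξ hξ
    · exact (fourierTransform_eq_zero_on_lineThrough_iff μ θ₂).2 h₂ ξ hξ
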